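/- **Setting.** A *polarized GoI situation* consists of a traced symmetric monoidal category $(\mathcal C,\otimes,I,s,\mathrm{Tr})$ with zero morphisms (a family $0_{XY}:X\to Y$ absorbing for composition), and: an object $U$ with morphisms $k:U\to U\otimes U$, $j:U\otimes U\to U$, $k\circ j=\mathrm{Id}$; an object $1$ (not necessarily $I$) with $!:1\otimes1\to1$, $r:1\to1\otimes1$, $!\circ r=\mathrm{Id}$; a distinguished point $\alpha:1\to U$ with a left inverse $\alpha^*$; morphisms $!_\alpha:U\otimes1\to U$, $r_\alpha:U\to U\otimes1$ with $!_\alpha r_\alpha=\mathrm{Id}$, $!_\alpha(\alpha\otimes1)=\alpha\,!$ and $r_\alpha\alpha=(\alpha\otimes1)r$; such that (uniformity) for all $p:1\to U$, $f:X\otimes U\to Y\otimes U$, $g:X\otimes1\to Y\otimes1$ with $f(X\otimes p)=(Y\otimes p)g$ one has $\mathrm{Tr}^U(f)=\mathrm{Tr}^1(g)$, and such that $(W\otimes!_\alpha)(f\otimes0_{11})(V\otimes r_\alpha)=f$ for all $f:V\otimes U\to W\otimes U$ and $(W\otimes!)(f\otimes0_{11})(V\otimes r)=f$ for all $f:V\otimes1\to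 W\otimes1$. Below, structural isomorphisms and permutations of tensor factors are left implicit. For a tensor product $X\otimes Y$ put $\iota_X=X\otimes0_{I,Y}:X\to X\otimes Y$ and $\rho_X=X\otimes0_{Y,I}:X\otimes Y\to X$, and similarly $\iota_Y,\rho_Y$. A morphism $f$ into $X\otimes Y$ *ranges over* $Y$ if $\iota_Y\rho_Yf=f$. **Logic.** $\mathsf{MLLP}$ has positive formulas $P::=X\mid P\otimes P\mid\mathbf 1\mid{\downarrow}N$ and negative formulas $N::=X^\perp\mid N\wp N\mid\bot\mid{\uparrow}P$, with $(P\otimes Q)^\perp=P^\perp\wp Q^\perp$, $({\downarrow}N)^\perp={\uparrow}N^\perp$, $\mathbf 1^\perp=\bot$, and $(-)^\perp$ an involution. Let $\mathcal M,\mathcal N$ be sequences of negative formulas, and $\Gamma,\Xi$ sequences with at most one positive formula. Up to exchange, the rules are: axiom $\vdash P^\perp,P$; from $\vdash\mathcal M,P$ and $\vdash\mathcal N,Q$ infer $\vdash\mathcal M,\mathcal N,P\otimes Q$; from $\vdash\Gamma,N,M$ infer $\vdash\Gamma,N\wp M$; from $\vdash\mathcal M,N$ infer $\vdash\mathcal M,{\downarrow}N$;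 from $\vdash\mathcal M,P$ infer $\vdash\mathcal M,{\uparrow}P$; and cut, from $\vdash\mathcal N,P$ and $\vdash P^\perp,\Xi$ infer $\vdash\mathcal N,\Xi$. A proof of $\vdash[\Delta],\Gamma$ is a proof of $\vdash\Gamma$ whose cut formulas are the pairs $P,P^\perp$ listed in $\Delta$. **Formulas.** Call the literals and the constants $\mathbf 1,\bot$ *atomic*. Put $U_A=U$ for every formula $A$. For $A$ atomic put $\mathbb 1_A=1$, $\mathbf U_A=A^U=U$, $A^D=I$. For a shift put $\mathbb 1_{\downarrow N}=\mathbb 1_{\uparrow P}=1$, $\mathbf U_{\downarrow N}=U\otimes\mathbf U_N$, $\mathbf U_{\uparrow P}=\mathbf U_P\otimes U$, $({\downarrow}N)^U=({\uparrow}P)^U=U$, $({\downarrow}N)^D=\mathbf U_N$, $({\uparrow}P)^D=\mathbf U_P$. All four assignments send $\otimes$ and $\wp$ to $\otimes$, and sequences to tensor products; thus $\mathbf U_A\cong A^U\otimes A^D$ and $\mathbb 1_A\cong1^m$. The folding $j_A:\mathbf U_A\to U$ is $\mathrm{Id}$ for atomic $A$, $j(j_A\otimes j_B)$ for $A\otimes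 B$ and $A\wp B$, and $j(U\otimes j_B)$ for ${\downarrow}B$ and for ${\uparrow}B$, where in both cases the factor $U$ of the shift is the left argument of $j$; $k_A:U\to\mathbf U_A$ is defined dually, so $k_Aj_A=\mathrm{Id}$. The multipoint of $A$ is $$\mathsf{mp}(A):\mathbb 1_A\xrightarrow{\alpha^m}A^U\cong A^U\otimes I\xrightarrow{A^U\otimes0}A^U\otimes A^D\cong\mathbf U_A\xrightarrow{j_A}U,$$ and $\mathsf{mp}(A_1,\dots,A_n)=\mathsf{mp}(A_1)\otimes\cdots\otimes\mathsf{mp}(A_n)$. Let $r_A:A^U\to A^U\otimes\mathbb 1_A$ and $!_A:A^U\otimes\mathbb 1_A\to A^U$ be the tensor powers of $r_\alpha$ and $!_\alpha$, and $\hat r_A=r_A\otimes A^D$, $\hat!_A={!_A}\otimes A^D$; similarly for sequences. Let $g_m={!}\circ(!\otimes1)\circ\cdots\circ(!\otimes1^{m-2}):1^m\to1$ and $h_m=(r\otimes1^{m-2})\circ\cdots\circ(r\otimes1)\circ r:1\to1^m$, with $g_1=h_1=\mathrm{Id}_1$, $g_0=0_{I,1}$, $h_0=0_{1,I}$. **Proofs.**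 A proof $\pi$ of $\vdash[\Delta],\Gamma$ is interpreted by endomorphisms $[\![\pi]\!]$ of $U_{\Gamma}\otimes U_\Delta$ and $f_\pi$ of $\mathbb 1_{\Gamma}\otimes\mathbb 1_\Delta$. For any $\pi$ write $[\![\pi]\!]^\dagger=k\circ[\![\pi]\!]\circ j$ with $k,j$ the tensor products of all $k_A,j_A$ over $\Delta,\Gamma$; in the cases $\otimes,\wp,\uparrow,\downarrow$ the formula below defines $[\![\pi]\!]^\dagger$ and one sets $[\![\pi]\!]=j\circ[\![\pi]\!]^\dagger\circ k$. * Axiom: $[\![\pi]\!]=s_{U,U}$, and $f_\pi$ is the symmetry of $\mathbb 1_P\otimes\mathbb 1_{P^\perp}$ through $\mathbb 1_P\cong\mathbb 1_{P^\perp}$. * Cut: $[\![\pi]\!]=[\![\pi']\!]\otimes[\![\pi'']\!]$, $f_\pi=f_{\pi'}\otimes f_{\pi''}$. The $\otimes$-rule: $[\![\pi]\!]^\dagger=[\![\pi']\!]^\dagger\otimes[\![\pi'']\!]^\dagger$, $f_\pi=f_{\pi'}\otimes f_{\pi''}$. * The $\wp$-rule: $[\![\pi]\!]^\dagger=[\![\pi']\!]^\dagger$,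 $f_\pi=f_{\pi'}$. Exchange acts by permuting the factors. * The $\uparrow$-rule: $[\![\pi]\!]^\dagger=0_{U,U}\otimes[\![\pi']\!]^\dagger$ and $f_\pi=0_{11}\otimes\big((0_{\mathbb 1_P,I}\otimes\mathrm{Id})\circ f_{\pi'}\circ(0_{I,\mathbb 1_P}\otimes\mathrm{Id})\big)$. * The $\downarrow$-rule, with $\mathbb 1_{\mathcal M}\cong1^m$: on $U\otimes\mathbf U_N\otimes\mathbf U_{\mathcal M}\otimes\mathbf U_\Delta$, $[\![\pi]\!]^\dagger$ applies $\hat r_{\mathcal M}$, then $(h_m\alpha^*:U\to1^m)\otimes[\![\pi']\!]^\dagger\otimes(\alpha g_m:1^m\to U)$, with $\alpha g_m$ acting on the copy of $1^m$ produced by $\hat r_{\mathcal M}$, then $\hat!_{\mathcal M}$, which absorbs the output of $h_m\alpha^*$. Similarly, on $1\otimes\mathbb 1_{\mathcal M}\otimes\mathbb 1_\Delta$, $f_\pi$ applies $r^m$ to $\mathbb 1_{\mathcal M}$, then $h_m\otimes\big((0_{\mathbb 1_N,I}\otimes\mathrm{Id})\circ f_{\pi'}\circ(0_{I,\mathbb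 1_N}\otimes\mathrm{Id})\big)\otimes g_m$, then $!^m$. Let $\sigma$ be the tensor product of the symmetries $s_{U,U}$ and $\sigma_*$ that of the symmetries of $\mathbb 1_P\otimes\mathbb 1_{P^\perp}$ through $\mathbb 1_P\cong\mathbb 1_{P^\perp}$, over the cut pairs $P,P^\perp$ in $\Delta$. The execution formulas are $$\mathsf{Ex}([\![\pi]\!],\sigma)=\mathrm{Tr}^{U_\Delta}\big((U_\Gamma\otimes\sigma)\circ[\![\pi]\!]\big),\qquad \mathsf{Ex}(f_\pi,\sigma_*)=\mathrm{Tr}^{\mathbb 1_\Delta}\big((\mathbb 1_\Gamma\otimes\sigma_*)\circ f_\pi\big).$$ **Proposition (focusing = invariance of $\mathsf{mp}$).** Let $\pi$ be an $\mathsf{MLLP}$ proof of $\vdash[\Delta],\mathcal N,P$ with $P$ positive and $\mathcal N$ a sequence of negative formulas. Then, in every polarized GoI situation, the restriction $\mathsf{Ex}(f_\pi,\sigma_*)\circ\iota_{\mathbb 1_P}:\mathbb 1_P\to\mathbb 1_{\mathcal N,P}$ ranges over $\mathbb 1_{\mathcal N}$, and $$\mathsf{Ex}([\![\pi]\!],\sigma)\circ\iota_{U_P}\circ\mathsf{mp}(P)=\iota_{U_{\mathcal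 N}}\circ\mathsf{mp}(\mathcal N)\circ\rho_{\mathbb 1_{\mathcal N}}\circ\mathsf{Ex}(f_\pi,\sigma_*)\circ\iota_{\mathbb 1_P}.$$ -/

import Mathlib

open CategoryTheory MonoidalCategory

universe v u w

noncomputable section

/-! ### Traced symmetric monoidal categories -/

/-- A trace on a symmetric monoidal category (the Joyal–Street–Verity axioms). -/
class TracedCategory (C : Type u) [Category.{v} C] [MonoidalCategory C] [SymmetricCategory C] where
  tr : ∀ (U : C) {X Y : C}, (X ⊗ U ⟶ Y ⊗ U) → (X ⟶ Y)
  tr_naturality_left : ∀ (U : C) {X X' Y : C} (g : X' ⟶ X) (f : X ⊗ U ⟶ Y ⊗ U),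
    tr U (g ▷ U ≫ f) = g ≫ tr U f
  tr_naturality_right : ∀ (U : C) {X Y Y' : C} (f : X ⊗ U ⟶ Y ⊗ U) (h : Y ⟶ Y'),
    tr U (f ≫ h ▷ U) = tr U f ≫ h
  tr_dinaturality : ∀ {U V X Y : C} (f : X ⊗ U ⟶ Y ⊗ V) (g : V ⟶ U),
    tr U (f ≫ Y ◁ g) = tr V (X ◁ g ≫ f)
  tr_vanishing_unit : ∀ {X Y : C} (f : X ⊗ 𝟙_ C ⟶ Y ⊗ 𝟙_ C),
    tr (𝟙_ C) f = (ρ_ X).inv ≫ f ≫ (ρ_ Y).hom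
  tr_vanishing_tensor : ∀ {U V X Y : C} (f : X ⊗ (U ⊗ V) ⟶ Y ⊗ (U ⊗ V)),
    tr (U ⊗ V) f = tr U (tr V ((α_ X U V).hom ≫ f ≫ (α_ Y U V).inv))
  tr_superposing : ∀ (U : C) {X Y : C} (Z : C) (f : X ⊗ U ⟶ Y ⊗ U),
    tr U ((α_ Z X U).hom ≫ Z ◁ f ≫ (α_ Z Y U).inv) = Z ◁ tr U f
  tr_yanking : ∀ U : C, tr U (β_ U U).hom = 𝟙 U

/-! ### Polarized GoI situations -/

/-- A polarized GoI situation on a traced symmetric monoidal category with zero morphisms.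
`one` is the object written `1`; it need not be the tensor unit. -/
structure PolarizedGoI (C : Type u) [Category.{v} C] [MonoidalCategory C] [SymmetricCategory C]
    [TracedCategory C] [Limits.HasZeroMorphisms C] where
  /-- the reflexive object, with the retraction `k ∘ j = id` -/
  U : C
  k : U ⟶ U ⊗ U
  j : U ⊗ U ⟶ U
  j_k : j ≫ k = 𝟙 (U ⊗ U)
  /-- the object `1`, with the retraction `! ∘ r = id` -/
  one : C
  bang : one ⊗ one ⟶ one
  r : one ⟶ one ⊗ one
  r_bang : r ≫ bang = 𝟙 one
  /-- the distinguished point -/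
  pt : one ⟶ U
  /-- uniformity of trace over points, i.e. over morphisms `1 ⟶ U` -/
  uniform : ∀ (p : one ⟶ U) {X Y : C} (f : X ⊗ U ⟶ Y ⊗ U) (g : X ⊗ one ⟶ Y ⊗ one),
    X ◁ p ≫ f = g ≫ Y ◁ p → TracedCategory.tr U f = TracedCategory.tr one g
  /-- the lifting of `(!, r)` along the distinguished point -/
  bangPt : U ⊗ one ⟶ U
  rPt : U ⟶ U ⊗ one
  rPt_bangPt : rPt ≫ bangPt = 𝟙 U
  pt_bangPt : pt ▷ one ≫ bangPt = bang ≫ pt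
  pt_rPt : pt ≫ rPt = r ≫ pt ▷ one
  /-- semi-invertibility of the distinguished point -/
  ptInv : U ⟶ one
  pt_ptInv : pt ≫ ptInv = 𝟙 one
  /-- compatibility of the retractions with the zero morphism `0 : 1 ⟶ 1` -/
  bangPt_zero : ∀ {V W : C} (f : V ⊗ U ⟶ W ⊗ U),
    V ◁ rPt ≫ (α_ V U one).inv ≫ (f ⊗ₘ (0 : one ⟶ one)) ≫ (α_ W U one).hom ≫ W ◁ bangPt = f
  bang_zero : ∀ {V W : C} (f : V ⊗ one ⟶ W ⊗ one),
    V ◁ r ≫ (α_ V one one).inv ≫ (f ⊗ₘ (0 : one ⟶ one)) ≫ (α_ W one one).hom ≫ W ◁ bang = f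

/-! ### Formulas and proofs of `MLLP` -/

inductive Polarity : Type
  | pos : Polarity
  | neg : Polarity

@[reducible] def Polarity.dual : Polarity → Polarity
  | .pos => .neg
  | .neg => .pos

/-- Positive and negative formulas over a type `At` of atoms. The constants `unit` (`𝟏`) and `bot` (`⊥`)
have no rules other than the axiom, and are interpreted below like a dual pair of literals. -/
inductive Form (At : Type w) : Polarity → Type w
  | atom (X : At) : Form At .pos
  | natom (X : At) : Form At .neg
  | tensor (P Q : Form At .pos) : Form At .pos
  | par (N M : Form At .neg) : Form At .neg
  | unit : Form At .pos
  | bot : Form At .neg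
  | down (N : Form At .neg) : Form At .pos
  | up (P : Form At .pos) : Form At .neg

/-- Negation, by de Morgan duality. -/
@[reducible] def Form.dual {At : Type w} : {p : Polarity} → Form At p → Form At p.dual
  | _, .atom X => .natom X
  | _, .natom X => .atom X
  | _, .tensor P Q => .par P.dual Q.dual
  | _, .par N M => .tensor N.dual M.dual
  | _, .unit => .bot
  | _, .bot => .unit
  | _, .down N => .up N.dual
  | _, .up P => .down P.dual

/-- Negation is involutive. -/
theorem Form.dual_dual {At : Type w} {p : Polarity} (A : Form At p) : HEq A.dual.dual A := by
  induction A <;> simp_all [Form.dual]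

/-- Permutations of a sequence, generated by adjacent transpositions. -/
inductive Exch {α : Type w} : List α → List α → Type w
  | refl (l : List α) : Exch l l
  | swap (a b : α) (l : List α) : Exch (a :: b :: l) (b :: a :: l)
  | cons (a : α) {l l' : List α} (e : Exch l l') : Exch (a :: l) (a :: l')
  | trans {l l' l'' : List α} (e : Exch l l') (e' : Exch l' l'') : Exch l l''

/-- `MLLP` proofs. `Proof Δ 𝒩 Θ` is the type of proofs of the sequent `⊢ [Δ], 𝒩, Θ` where `𝒩` is a
sequence of negative formulas, `Θ` is a positive formula or is absent, and `Δ` lists the positive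
formulas `P` of the pairs `P, P^⊥` that were cut. -/
inductive Proof {At : Type w} :
    List (Form At .pos) → List (Form At .neg) → Option (Form At .pos) → Type w
  | ax (P : Form At .pos) : Proof [] [P.dual] (some P)
  | exch {Δ : List (Form At .pos)} {𝒩 𝒩' : List (Form At .neg)} {Θ : Option (Form At .pos)}
      (e : Exch 𝒩 𝒩') (π : Proof Δ 𝒩 Θ) : Proof Δ 𝒩' Θ
  | cut {Δ' Δ'' : List (Form At .pos)} {𝒩 Ξ : List (Form At .neg)} {Θ : Option (Form At .pos)}
      {P : Form At .pos} (π' : Proof Δ' 𝒩 (some P)) (π'' : Proof Δ'' (P.dual :: Ξ) Θ) :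
      Proof (P :: (Δ' ++ Δ'')) (𝒩 ++ Ξ) Θ
  | tensor {Δ' Δ'' : List (Form At .pos)} {ℳ 𝒩 : List (Form At .neg)} {P Q : Form At .pos}
      (π' : Proof Δ' ℳ (some P)) (π'' : Proof Δ'' 𝒩 (some Q)) :
      Proof (Δ' ++ Δ'') (ℳ ++ 𝒩) (some (.tensor P Q))
  | par {Δ : List (Form At .pos)} {𝒩 : List (Form At .neg)} {Θ : Option (Form At .pos)}
      {N M : Form At .neg} (π : Proof Δ (N :: M :: 𝒩) Θ) : Proof Δ (.par N M :: 𝒩) Θ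
  | down {Δ : List (Form At .pos)} {ℳ : List (Form At .neg)} {N : Form At .neg}
      (π : Proof Δ (N :: ℳ) none) : Proof Δ ℳ (some (.down N))
  | up {Δ : List (Form At .pos)} {ℳ : List (Form At .neg)} {P : Form At .pos}
      (π : Proof Δ ℳ (some P)) : Proof Δ (.up P :: ℳ) none

/-! ### Rearrangements of tensor factors in a symmetric monoidal category

Each of these isomorphisms is composed of structural isomorphisms only. -/

section Rearrange

variable {C : Type u} [Category.{v} C] [MonoidalCategory C] [SymmetricCategory C]

/-- middle-four interchange -/
def midIso (W X Y Z : C) : (W ⊗ X) ⊗ (Y ⊗ Z) ≅ (W ⊗ Y) ⊗ (X ⊗ Z) where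
  hom := tensorμ W X Y Z
  inv := tensorδ W X Y Z
  hom_inv_id := tensorμ_tensorδ W X Y Z
  inv_hom_id := tensorδ_tensorμ W X Y Z

def leftComm (X Y Z : C) : X ⊗ (Y ⊗ Z) ≅ Y ⊗ (X ⊗ Z) :=
  (α_ X Y Z).symm ≪≫ (β_ X Y ⊗ᵢ Iso.refl Z) ≪≫ α_ Y X Z

def axTau (P Pd : C) : (P ⊗ (Pd ⊗ 𝟙_ C)) ⊗ 𝟙_ C ≅ P ⊗ Pd :=
  ρ_ _ ≪≫ (Iso.refl P ⊗ᵢ ρ_ Pd)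

def cutTau (A n x P Pd d' d'' : C) :
    (A ⊗ (n ⊗ x)) ⊗ ((P ⊗ Pd) ⊗ (d' ⊗ d'')) ≅ ((P ⊗ n) ⊗ d') ⊗ ((A ⊗ (Pd ⊗ x)) ⊗ d'') :=
  (leftComm A n x ⊗ᵢ midIso P Pd d' d'') ≪≫ midIso n (A ⊗ x) (P ⊗ d') (Pd ⊗ d'') ≪≫
    ((leftComm n P d' ≪≫ (α_ P n d').symm) ⊗ᵢ
      (midIso A x Pd d'' ≪≫ (α_ (A ⊗ Pd) x d'').symm ≪≫ (α_ A Pd x ⊗ᵢ Iso.refl d'')))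

def tensorTau (P Q m n d' d'' : C) :
    ((P ⊗ Q) ⊗ (m ⊗ n)) ⊗ (d' ⊗ d'') ≅ ((P ⊗ m) ⊗ d') ⊗ ((Q ⊗ n) ⊗ d'') :=
  (midIso P Q m n ⊗ᵢ Iso.refl (d' ⊗ d'')) ≪≫ midIso (P ⊗ m) (Q ⊗ n) d' d''

def parTau (A N M n d : C) : (A ⊗ ((N ⊗ M) ⊗ n)) ⊗ d ≅ (A ⊗ (N ⊗ (M ⊗ n))) ⊗ d :=
  (Iso.refl A ⊗ᵢ α_ N M n) ⊗ᵢ Iso.refl d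

def upTau (P T n d : C) : (𝟙_ C ⊗ ((P ⊗ T) ⊗ n)) ⊗ d ≅ T ⊗ ((P ⊗ n) ⊗ d) :=
  ((λ_ _ ≪≫ (β_ P T ⊗ᵢ Iso.refl n) ≪≫ α_ T P n) ⊗ᵢ Iso.refl d) ≪≫ α_ T (P ⊗ n) d

def downTau (T N n W d : C) :
    ((T ⊗ N) ⊗ (n ⊗ W)) ⊗ d ≅ T ⊗ (((𝟙_ C ⊗ (N ⊗ n)) ⊗ d) ⊗ W) :=
  (((α_ T N (n ⊗ W) ≪≫ (Iso.refl T ⊗ᵢ (α_ N n W).symm)) ⊗ᵢ Iso.refl d) ≪≫ α_ T ((N ⊗ n) ⊗ W) d) ≪≫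
    (Iso.refl T ⊗ᵢ (α_ (N ⊗ n) W d ≪≫ (Iso.refl (N ⊗ n) ⊗ᵢ β_ W d) ≪≫ (α_ (N ⊗ n) d W).symm ≪≫
      (((λ_ (N ⊗ n)).symm ⊗ᵢ Iso.refl d) ⊗ᵢ Iso.refl W)))

/-- exchange of the outer factors -/
def outerSwap (W X T : C) : W ⊗ (X ⊗ T) ≅ T ⊗ (X ⊗ W) :=
  leftComm W X T ≪≫ (Iso.refl X ⊗ᵢ β_ W T) ≪≫ leftComm X T W

end Rearrange

/-! ### Quasi-injections and quasi-projections -/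

section Quasi

variable {C : Type u} [Category.{v} C] [MonoidalCategory C] [Limits.HasZeroMorphisms C]

def quasiInl (X Y : C) : X ⟶ X ⊗ Y := (ρ_ X).inv ≫ X ◁ (0 : 𝟙_ C ⟶ Y)

def quasiInr (X Y : C) : Y ⟶ X ⊗ Y := (λ_ Y).inv ≫ (0 : 𝟙_ C ⟶ X) ▷ Y

def quasiFst (X Y : C) : X ⊗ Y ⟶ X := X ◁ (0 : Y ⟶ 𝟙_ C) ≫ (ρ_ X).hom

def quasiSnd (X Y : C) : X ⊗ Y ⟶ Y := (0 : X ⟶ 𝟙_ C) ▷ Y ≫ (λ_ Y).hom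

/-- `f` ranges over the right factor of its codomain `X ⊗ Y`. -/
def RangesOverRight {Z X Y : C} (f : Z ⟶ X ⊗ Y) : Prop :=
  f ≫ quasiSnd X Y ≫ quasiInr X Y = f

end Quasi

/-! ### Objects and morphisms assigned to sequences and sequents -/

section Interface

variable {C : Type u} [Category.{v} C] [MonoidalCategory C] {At : Type w}

/-- an assignment of objects to formulas -/
abbrev Asg (At : Type w) (C : Type u) := (p : Polarity) → Form At p → C

/-- the tensor product of the objects of a sequence of negative formulas -/
@[reducible] def negObj (F : Asg At C) : List (Form At .neg) → C
  | [] => 𝟙_ C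
  | N :: 𝒩 => F .neg N ⊗ negObj F 𝒩

@[reducible] def posObj (F : Asg At C) : Option (Form At .pos) → C
  | none => 𝟙_ C
  | some P => F .pos P

/-- the tensor product of the objects of the cut formulas -/
@[reducible] def cutObj (F : Asg At C) : List (Form At .pos) → C
  | [] => 𝟙_ C
  | P :: Δ => (F .pos P ⊗ F .neg P.dual) ⊗ cutObj F Δ

/-- the object of the conclusions `𝒩, Θ`, the positive formula coming first -/
abbrev conclObj (F : Asg At C) (𝒩 : List (Form At .neg)) (Θ : Option (Form At .pos)) : C :=
  posObj F Θ ⊗ negObj F 𝒩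

/-- the interface of `⊢ [Δ], 𝒩, Θ` -/
abbrev iface (F : Asg At C) (Δ : List (Form At .pos)) (𝒩 : List (Form At .neg))
    (Θ : Option (Form At .pos)) : C :=
  conclObj F 𝒩 Θ ⊗ cutObj F Δ

variable {F G : Asg At C}

def negMap (φ : ∀ p A, F p A ⟶ G p A) : ∀ 𝒩 : List (Form At .neg), negObj F 𝒩 ⟶ negObj G 𝒩
  | [] => 𝟙 (𝟙_ C)
  | N :: 𝒩 => φ .neg N ⊗ₘ negMap φ 𝒩

def posMap (φ : ∀ p A, F p A ⟶ G p A) : ∀ Θ : Option (Form At .pos), posObj F Θ ⟶ posObj G Θ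
  | none => 𝟙 (𝟙_ C)
  | some P => φ .pos P

def cutMap (φ : ∀ p A, F p A ⟶ G p A) : ∀ Δ : List (Form At .pos), cutObj F Δ ⟶ cutObj G Δ
  | [] => 𝟙 (𝟙_ C)
  | P :: Δ => (φ .pos P ⊗ₘ φ .neg P.dual) ⊗ₘ cutMap φ Δ

def ifaceMap (φ : ∀ p A, F p A ⟶ G p A) (Δ : List (Form At .pos)) (𝒩 : List (Form At .neg))
    (Θ : Option (Form At .pos)) : iface F Δ 𝒩 Θ ⟶ iface G Δ 𝒩 Θ :=
  (posMap φ Θ ⊗ₘ negMap φ 𝒩) ⊗ₘ cutMap φ Δ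

variable (F)

def negAppend : ∀ 𝒩 ℳ : List (Form At .neg), negObj F (𝒩 ++ ℳ) ≅ negObj F 𝒩 ⊗ negObj F ℳ
  | [], ℳ => (λ_ (negObj F ℳ)).symm
  | N :: 𝒩, ℳ => (Iso.refl (F .neg N) ⊗ᵢ negAppend 𝒩 ℳ) ≪≫
      (α_ (F .neg N) (negObj F 𝒩) (negObj F ℳ)).symm

def cutAppend : ∀ Δ Δ' : List (Form At .pos), cutObj F (Δ ++ Δ') ≅ cutObj F Δ ⊗ cutObj F Δ'
  | [], Δ' => (λ_ (cutObj F Δ')).symm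
  | P :: Δ, Δ' => (Iso.refl (F .pos P ⊗ F .neg P.dual) ⊗ᵢ cutAppend Δ Δ') ≪≫
      (α_ (F .pos P ⊗ F .neg P.dual) (cutObj F Δ) (cutObj F Δ')).symm

variable [SymmetricCategory C]

def exchIso : ∀ {𝒩 𝒩' : List (Form At .neg)}, Exch 𝒩 𝒩' → (negObj F 𝒩 ≅ negObj F 𝒩')
  | _, _, .refl 𝒩 => Iso.refl (negObj F 𝒩)
  | _, _, .swap N M 𝒩 => leftComm (F .neg N) (F .neg M) (negObj F 𝒩)
  | _, _, .cons N e => Iso.refl (F .neg N) ⊗ᵢ exchIso e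
  | _, _, .trans e e' => exchIso e ≪≫ exchIso e'

/-- the exchange `τ` of the interfaces in a cut -/
def cutIface (Δ' Δ'' : List (Form At .pos)) (𝒩 Ξ : List (Form At .neg))
    (Θ : Option (Form At .pos)) (P : Form At .pos) :
    iface F (P :: (Δ' ++ Δ'')) (𝒩 ++ Ξ) Θ ≅
      iface F Δ' 𝒩 (some P) ⊗ iface F Δ'' (P.dual :: Ξ) Θ :=
  ((Iso.refl (posObj F Θ) ⊗ᵢ negAppend F 𝒩 Ξ) ⊗ᵢ
    (Iso.refl (F .pos P ⊗ F .neg P.dual) ⊗ᵢ cutAppend F Δ' Δ'')) ≪≫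
  cutTau (posObj F Θ) (negObj F 𝒩) (negObj F Ξ) (F .pos P) (F .neg P.dual)
    (cutObj F Δ') (cutObj F Δ'')

/-- the exchange of the interfaces in a `⊗`-rule, before `P ⊗ Q` is formed -/
def tensorIface (Δ' Δ'' : List (Form At .pos)) (ℳ 𝒩 : List (Form At .neg)) (P Q : Form At .pos) :
    ((F .pos P ⊗ F .pos Q) ⊗ negObj F (ℳ ++ 𝒩)) ⊗ cutObj F (Δ' ++ Δ'') ≅
      iface F Δ' ℳ (some P) ⊗ iface F Δ'' 𝒩 (some Q) :=
  ((Iso.refl (F .pos P ⊗ F .pos Q) ⊗ᵢ negAppend F ℳ 𝒩) ⊗ᵢ cutAppend F Δ' Δ'') ≪≫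
  tensorTau (F .pos P) (F .pos Q) (negObj F ℳ) (negObj F 𝒩) (cutObj F Δ') (cutObj F Δ'')

def exchIface (Δ : List (Form At .pos)) {𝒩 𝒩' : List (Form At .neg)} (e : Exch 𝒩 𝒩')
    (Θ : Option (Form At .pos)) : iface F Δ 𝒩' Θ ≅ iface F Δ 𝒩 Θ :=
  (Iso.refl (posObj F Θ) ⊗ᵢ (exchIso F e).symm) ⊗ᵢ Iso.refl (cutObj F Δ)

end Interface

/-! ### Multipoints of formulas and the two-layered interpretation of proofs -/

namespace PolarizedGoI

variable {C : Type u} [Category.{v} C] [MonoidalCategory C] [SymmetricCategory C]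
  [TracedCategory C] [Limits.HasZeroMorphisms C] (S : PolarizedGoI C) {At : Type w}

/-- the object `𝟙_A`, a tensor product of `1`s -/
@[reducible] def oneObj : {p : Polarity} → Form At p → C
  | _, .tensor P Q => oneObj P ⊗ oneObj Q
  | _, .par N M => oneObj N ⊗ oneObj M
  | _, .atom _ => S.one
  | _, .natom _ => S.one
  | _, .unit => S.one
  | _, .bot => S.one
  | _, .down _ => S.one
  | _, .up _ => S.one

/-- the object `𝐔_A`, a tensor product of `U`s -/
@[reducible] def bU : {p : Polarity} → Form At p → C
  | _, .tensor P Q => bU P ⊗ bU Q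
  | _, .par N M => bU N ⊗ bU M
  | _, .atom _ => S.U
  | _, .natom _ => S.U
  | _, .unit => S.U
  | _, .bot => S.U
  | _, .down N => S.U ⊗ bU N
  | _, .up P => bU P ⊗ S.U

/-- the object `A^U` -/
@[reducible] def upperU : {p : Polarity} → Form At p → C
  | _, .tensor P Q => upperU P ⊗ upperU Q
  | _, .par N M => upperU N ⊗ upperU M
  | _, .atom _ => S.U
  | _, .natom _ => S.U
  | _, .unit => S.U
  | _, .bot => S.U
  | _, .down _ => S.U
  | _, .up _ => S.U

/-- the object `A^D` -/
@[reducible] def upperD : {p : Polarity} → Form At p → C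
  | _, .tensor P Q => upperD P ⊗ upperD Q
  | _, .par N M => upperD N ⊗ upperD M
  | _, .atom _ => 𝟙_ C
  | _, .natom _ => 𝟙_ C
  | _, .unit => 𝟙_ C
  | _, .bot => 𝟙_ C
  | _, .down N => S.bU N
  | _, .up P => S.bU P

/-- the canonical isomorphism `𝐔_A ≅ A^U ⊗ A^D` -/
def splitIso : {p : Polarity} → (A : Form At p) → (S.bU A ≅ S.upperU A ⊗ S.upperD A)
  | _, .tensor P Q => (splitIso P ⊗ᵢ splitIso Q) ≪≫
      midIso (S.upperU P) (S.upperD P) (S.upperU Q) (S.upperD Q)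
  | _, .par N M => (splitIso N ⊗ᵢ splitIso M) ≪≫
      midIso (S.upperU N) (S.upperD N) (S.upperU M) (S.upperD M)
  | _, .atom _ => (ρ_ S.U).symm
  | _, .natom _ => (ρ_ S.U).symm
  | _, .unit => (ρ_ S.U).symm
  | _, .bot => (ρ_ S.U).symm
  | _, .down N => Iso.refl (S.U ⊗ S.bU N)
  | _, .up P => β_ (S.bU P) S.U

/-- the folding `j_A : 𝐔_A ⟶ U`. Dual formulas are folded in the same way: for `↓N` and `↑P` the
factor `U` of the shift becomes the left argument of `j`. -/
def foldU : {p : Polarity} → (A : Form At p) → (S.bU A ⟶ S.U)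
  | _, .tensor P Q => (foldU P ⊗ₘ foldU Q) ≫ S.j
  | _, .par N M => (foldU N ⊗ₘ foldU M) ≫ S.j
  | _, .atom _ => 𝟙 S.U
  | _, .natom _ => 𝟙 S.U
  | _, .unit => 𝟙 S.U
  | _, .bot => 𝟙 S.U
  | _, .down N => S.U ◁ foldU N ≫ S.j
  | _, .up P => (β_ (S.bU P) S.U).hom ≫ S.U ◁ foldU P ≫ S.j

/-- the unfolding `k_A : U ⟶ 𝐔_A` -/
def unfoldU : {p : Polarity} → (A : Form At p) → (S.U ⟶ S.bU A)
  | _, .tensor P Q => S.k ≫ (unfoldU P ⊗ₘ unfoldU Q)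
  | _, .par N M => S.k ≫ (unfoldU N ⊗ₘ unfoldU M)
  | _, .atom _ => 𝟙 S.U
  | _, .natom _ => 𝟙 S.U
  | _, .unit => 𝟙 S.U
  | _, .bot => 𝟙 S.U
  | _, .down N => S.k ≫ S.U ◁ unfoldU N
  | _, .up P => S.k ≫ S.U ◁ unfoldU P ≫ (β_ S.U (S.bU P)).hom

/-- `𝐔_A` is a retract of `U`. -/
theorem foldU_unfoldU {p : Polarity} (A : Form At p) :
    S.foldU A ≫ S.unfoldU A = 𝟙 (S.bU A) := by
  have key : ∀ {X Y : C} (f : X ⟶ S.U ⊗ S.U) (g : S.U ⊗ S.U ⟶ Y), (f ≫ S.j) ≫ S.k ≫ g = f ≫ g := by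
    intro X Y f g
    rw [Category.assoc, ← Category.assoc S.j, S.j_k, Category.id_comp]
  induction A with
  | atom X => exact Category.id_comp _
  | natom X => exact Category.id_comp _
  | unit => exact Category.id_comp _
  | bot => exact Category.id_comp _
  | tensor P Q hP hQ =>
    refine (key _ _).trans ?_
    rw [tensorHom_comp_tensorHom, hP, hQ]; exact id_tensorHom_id _ _
  | par N M hN hM =>
    refine (key _ _).trans ?_
    rw [tensorHom_comp_tensorHom, hN, hM]; exact id_tensorHom_id _ _
  | down N hN =>
    refine (key _ _).trans ?_
    rw [← whiskerLeft_comp, hN]; exact whiskerLeft_id _ _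
  | up P hP =>
    change ((β_ (S.bU P) S.U).hom ≫ S.U ◁ S.foldU P ≫ S.j) ≫ S.k ≫ S.U ◁ S.unfoldU P ≫
      (β_ S.U (S.bU P)).hom = 𝟙 (S.bU P ⊗ S.U)
    rw [← Category.assoc (β_ (S.bU P) S.U).hom, key, Category.assoc, ← whiskerLeft_comp_assoc, hP,
      whiskerLeft_id, Category.id_comp, SymmetricCategory.symmetry]

/-- the tensor power `α^m : 𝟙_A ⟶ A^U` of the distinguished point -/
def ptPow : {p : Polarity} → (A : Form At p) → (S.oneObj A ⟶ S.upperU A)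
  | _, .tensor P Q => ptPow P ⊗ₘ ptPow Q
  | _, .par N M => ptPow N ⊗ₘ ptPow M
  | _, .atom _ => S.pt
  | _, .natom _ => S.pt
  | _, .unit => S.pt
  | _, .bot => S.pt
  | _, .down _ => S.pt
  | _, .up _ => S.pt

/-- the multipoint `mp(A) : 𝟙_A ⟶ U` -/
def mp {p : Polarity} (A : Form At p) : S.oneObj A ⟶ S.U :=
  S.ptPow A ≫ (ρ_ (S.upperU A)).inv ≫ S.upperU A ◁ (0 : 𝟙_ C ⟶ S.upperD A) ≫
    (S.splitIso A).inv ≫ S.foldU A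

/-- the retraction `r_A : A^U ⟶ A^U ⊗ 𝟙_A` -/
def rU : {p : Polarity} → (A : Form At p) → (S.upperU A ⟶ S.upperU A ⊗ S.oneObj A)
  | _, .tensor P Q => (rU P ⊗ₘ rU Q) ≫
      (midIso (S.upperU P) (S.oneObj P) (S.upperU Q) (S.oneObj Q)).hom
  | _, .par N M => (rU N ⊗ₘ rU M) ≫
      (midIso (S.upperU N) (S.oneObj N) (S.upperU M) (S.oneObj M)).hom
  | _, .atom _ => S.rPt
  | _, .natom _ => S.rPt
  | _, .unit => S.rPt
  | _, .bot => S.rPt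
  | _, .down _ => S.rPt
  | _, .up _ => S.rPt

/-- the retraction `!_A : A^U ⊗ 𝟙_A ⟶ A^U` -/
def bangU : {p : Polarity} → (A : Form At p) → (S.upperU A ⊗ S.oneObj A ⟶ S.upperU A)
  | _, .tensor P Q => (midIso (S.upperU P) (S.oneObj P) (S.upperU Q) (S.oneObj Q)).inv ≫
      (bangU P ⊗ₘ bangU Q)
  | _, .par N M => (midIso (S.upperU N) (S.oneObj N) (S.upperU M) (S.oneObj M)).inv ≫
      (bangU N ⊗ₘ bangU M)
  | _, .atom _ => S.bangPt
  | _, .natom _ => S.bangPt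
  | _, .unit => S.bangPt
  | _, .bot => S.bangPt
  | _, .down _ => S.bangPt
  | _, .up _ => S.bangPt

/-- `r̂_A : 𝐔_A ⟶ 𝐔_A ⊗ 𝟙_A`, i.e. `r_A ⊗ A^D` -/
def rHat {p : Polarity} (A : Form At p) : S.bU A ⟶ S.bU A ⊗ S.oneObj A :=
  (S.splitIso A).hom ≫ S.rU A ▷ S.upperD A ≫
    (α_ (S.upperU A) (S.oneObj A) (S.upperD A)).hom ≫
    S.upperU A ◁ (β_ (S.oneObj A) (S.upperD A)).hom ≫
    (α_ (S.upperU A) (S.upperD A) (S.oneObj A)).inv ≫ (S.splitIso A).inv ▷ S.oneObj A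

/-- `!̂_A : 𝐔_A ⊗ 𝟙_A ⟶ 𝐔_A`, i.e. `!_A ⊗ A^D` -/
def bangHat {p : Polarity} (A : Form At p) : S.bU A ⊗ S.oneObj A ⟶ S.bU A :=
  (S.splitIso A).hom ▷ S.oneObj A ≫ (α_ (S.upperU A) (S.upperD A) (S.oneObj A)).hom ≫
    S.upperU A ◁ (β_ (S.upperD A) (S.oneObj A)).hom ≫
    (α_ (S.upperU A) (S.oneObj A) (S.upperD A)).inv ≫
    S.bangU A ▷ S.upperD A ≫ (S.splitIso A).inv

/-- the tensor power `r^m : 𝟙_A ⟶ 𝟙_A ⊗ 𝟙_A` of `r` -/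
def rPow : {p : Polarity} → (A : Form At p) → (S.oneObj A ⟶ S.oneObj A ⊗ S.oneObj A)
  | _, .tensor P Q => (rPow P ⊗ₘ rPow Q) ≫
      (midIso (S.oneObj P) (S.oneObj P) (S.oneObj Q) (S.oneObj Q)).hom
  | _, .par N M => (rPow N ⊗ₘ rPow M) ≫
      (midIso (S.oneObj N) (S.oneObj N) (S.oneObj M) (S.oneObj M)).hom
  | _, .atom _ => S.r
  | _, .natom _ => S.r
  | _, .unit => S.r
  | _, .bot => S.r
  | _, .down _ => S.r
  | _, .up _ => S.r

/-- the tensor power `!^m : 𝟙_A ⊗ 𝟙_A ⟶ 𝟙_A` of `!` -/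
def bangPow : {p : Polarity} → (A : Form At p) → (S.oneObj A ⊗ S.oneObj A ⟶ S.oneObj A)
  | _, .tensor P Q => (midIso (S.oneObj P) (S.oneObj P) (S.oneObj Q) (S.oneObj Q)).inv ≫
      (bangPow P ⊗ₘ bangPow Q)
  | _, .par N M => (midIso (S.oneObj N) (S.oneObj N) (S.oneObj M) (S.oneObj M)).inv ≫
      (bangPow N ⊗ₘ bangPow M)
  | _, .atom _ => S.bang
  | _, .natom _ => S.bang
  | _, .unit => S.bang
  | _, .bot => S.bang
  | _, .down _ => S.bang
  | _, .up _ => S.bang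

/-- the isomorphism `𝟙_A ≅ 𝟙_{A^⊥}` induced by de Morgan duality -/
def dualIso : {p : Polarity} → (A : Form At p) → (S.oneObj A ≅ S.oneObj A.dual)
  | _, .tensor P Q => dualIso P ⊗ᵢ dualIso Q
  | _, .par N M => dualIso N ⊗ᵢ dualIso M
  | _, .atom _ => Iso.refl S.one
  | _, .natom _ => Iso.refl S.one
  | _, .unit => Iso.refl S.one
  | _, .bot => Iso.refl S.one
  | _, .down _ => Iso.refl S.one
  | _, .up _ => Iso.refl S.one

/-- `A ↦ U_A := U` -/
abbrev asgU : Asg At C := fun _ _ => S.U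

/-- `A ↦ 𝐔_A` -/
abbrev asgB : Asg At C := fun _ A => S.bU A

/-- `A ↦ 𝟙_A` -/
abbrev asgOne : Asg At C := fun _ A => S.oneObj A

/-- `r̂` for a sequence of formulas -/
def rHatSeq : ∀ ℳ : List (Form At .neg),
    negObj S.asgB ℳ ⟶ negObj S.asgB ℳ ⊗ negObj S.asgOne ℳ
  | [] => (λ_ (𝟙_ C)).inv
  | N :: ℳ => (S.rHat N ⊗ₘ rHatSeq ℳ) ≫
      (midIso (S.bU N) (S.oneObj N) (negObj S.asgB ℳ) (negObj S.asgOne ℳ)).hom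

/-- `!̂` for a sequence of formulas -/
def bangHatSeq : ∀ ℳ : List (Form At .neg),
    negObj S.asgB ℳ ⊗ negObj S.asgOne ℳ ⟶ negObj S.asgB ℳ
  | [] => (λ_ (𝟙_ C)).hom
  | N :: ℳ => (midIso (S.bU N) (S.oneObj N) (negObj S.asgB ℳ) (negObj S.asgOne ℳ)).inv ≫
      (S.bangHat N ⊗ₘ bangHatSeq ℳ)

/-- `r^m` for a sequence of formulas -/
def rPowSeq : ∀ ℳ : List (Form At .neg),
    negObj S.asgOne ℳ ⟶ negObj S.asgOne ℳ ⊗ negObj S.asgOne ℳ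
  | [] => (λ_ (𝟙_ C)).inv
  | N :: ℳ => (S.rPow N ⊗ₘ rPowSeq ℳ) ≫
      (midIso (S.oneObj N) (S.oneObj N) (negObj S.asgOne ℳ) (negObj S.asgOne ℳ)).hom

/-- `!^m` for a sequence of formulas -/
def bangPowSeq : ∀ ℳ : List (Form At .neg),
    negObj S.asgOne ℳ ⊗ negObj S.asgOne ℳ ⟶ negObj S.asgOne ℳ
  | [] => (λ_ (𝟙_ C)).hom
  | N :: ℳ => (midIso (S.oneObj N) (S.oneObj N) (negObj S.asgOne ℳ) (negObj S.asgOne ℳ)).inv ≫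
      (S.bangPow N ⊗ₘ bangPowSeq ℳ)

/-- the tensor power `1^m` -/
@[reducible] def onePow : ℕ → C
  | 0 => 𝟙_ C
  | m + 1 => onePow m ⊗ S.one

def onePowAdd (a : ℕ) : ∀ b : ℕ, S.onePow a ⊗ S.onePow b ≅ S.onePow (a + b)
  | 0 => ρ_ (S.onePow a)
  | b + 1 => (α_ (S.onePow a) (S.onePow b) S.one).symm ≪≫
      (onePowAdd a b ⊗ᵢ Iso.refl S.one)

/-- the number `m` with `𝟙_A ≅ 1^m` -/
@[reducible] def width : {p : Polarity} → Form At p → ℕ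
  | _, .tensor P Q => width P + width Q
  | _, .par N M => width N + width M
  | _, .atom _ => 1
  | _, .natom _ => 1
  | _, .unit => 1
  | _, .bot => 1
  | _, .down _ => 1
  | _, .up _ => 1

/-- the canonical isomorphism `𝟙_A ≅ 1^m` -/
def oneIso : {p : Polarity} → (A : Form At p) → (S.oneObj A ≅ S.onePow (width A))
  | _, .tensor P Q => (oneIso P ⊗ᵢ oneIso Q) ≪≫ S.onePowAdd (width P) (width Q)
  | _, .par N M => (oneIso N ⊗ᵢ oneIso M) ≪≫ S.onePowAdd (width N) (width M)
  | _, .atom _ => (λ_ S.one).symm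
  | _, .natom _ => (λ_ S.one).symm
  | _, .unit => (λ_ S.one).symm
  | _, .bot => (λ_ S.one).symm
  | _, .down _ => (λ_ S.one).symm
  | _, .up _ => (λ_ S.one).symm

/-- the number `m` with `𝟙_ℳ ≅ 1^m` -/
@[reducible] def widthSeq : List (Form At .neg) → ℕ
  | [] => 0
  | N :: ℳ => width N + widthSeq ℳ

def oneIsoSeq : ∀ ℳ : List (Form At .neg), negObj S.asgOne ℳ ≅ S.onePow (widthSeq ℳ)
  | [] => Iso.refl (𝟙_ C)
  | N :: ℳ => (S.oneIso N ⊗ᵢ oneIsoSeq ℳ) ≪≫ S.onePowAdd (width N) (widthSeq ℳ)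

/-- `g_m : 1^m ⟶ 1`, the iterate `! ∘ (! ⊗ 1) ∘ ⋯ ∘ (! ⊗ 1^{m-2})`. It is the identity of `1` for
`m = 1` and the zero morphism for `m = 0`. -/
def gMap : ∀ m : ℕ, S.onePow m ⟶ S.one
  | 0 => 0
  | 1 => (λ_ S.one).hom
  | m + 2 => gMap (m + 1) ▷ S.one ≫ S.bang

/-- `h_m : 1 ⟶ 1^m`, the iterate `(r ⊗ 1^{m-2}) ∘ ⋯ ∘ (r ⊗ 1) ∘ r`. It is the identity of `1` for
`m = 1` and the zero morphism for `m = 0`. -/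
def hMap : ∀ m : ℕ, S.one ⟶ S.onePow m
  | 0 => 0
  | 1 => (λ_ S.one).inv
  | m + 2 => S.r ≫ hMap (m + 1) ▷ S.one

/-- `g_m : 𝟙_ℳ ≅ 1^m ⟶ 1` -/
def gSeq (ℳ : List (Form At .neg)) : negObj S.asgOne ℳ ⟶ S.one :=
  (S.oneIsoSeq ℳ).hom ≫ S.gMap (widthSeq ℳ)

/-- `h_m : 1 ⟶ 1^m ≅ 𝟙_ℳ` -/
def hSeq (ℳ : List (Form At .neg)) : S.one ⟶ negObj S.asgOne ℳ :=
  S.hMap (widthSeq ℳ) ≫ (S.oneIsoSeq ℳ).inv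

section Layers

variable (Δ : List (Form At .pos)) (𝒩 : List (Form At .neg)) (Θ : Option (Form At .pos))

/-- passage from an endomorphism of the `U_A`s to one of the `𝐔_A`s, by `k ∘ x ∘ j` -/
def dagger (x : iface S.asgU Δ 𝒩 Θ ⟶ iface S.asgU Δ 𝒩 Θ) :
    iface S.asgB Δ 𝒩 Θ ⟶ iface S.asgB Δ 𝒩 Θ :=
  ifaceMap (F := S.asgB) (G := S.asgU) (fun _ A => S.foldU A) Δ 𝒩 Θ ≫ x ≫
    ifaceMap (F := S.asgU) (G := S.asgB) (fun _ A => S.unfoldU A) Δ 𝒩 Θ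

/-- passage from an endomorphism of the `𝐔_A`s to one of the `U_A`s, by `j ∘ x ∘ k` -/
def undagger (x : iface S.asgB Δ 𝒩 Θ ⟶ iface S.asgB Δ 𝒩 Θ) :
    iface S.asgU Δ 𝒩 Θ ⟶ iface S.asgU Δ 𝒩 Θ :=
  ifaceMap (F := S.asgU) (G := S.asgB) (fun _ A => S.unfoldU A) Δ 𝒩 Θ ≫ x ≫
    ifaceMap (F := S.asgB) (G := S.asgU) (fun _ A => S.foldU A) Δ 𝒩 Θ

end Layers

/-- the upper layer of the `↓`-rule -/
def downUpper (Δ : List (Form At .pos)) (ℳ : List (Form At .neg)) (N : Form At .neg)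
    (x : iface S.asgB Δ (N :: ℳ) none ⟶ iface S.asgB Δ (N :: ℳ) none) :
    iface S.asgB Δ ℳ (some (.down N)) ⟶ iface S.asgB Δ ℳ (some (.down N)) :=
  let d := cutObj S.asgB Δ
  let n := negObj S.asgB ℳ
  let W := negObj S.asgOne ℳ
  (((S.U ⊗ S.bU N) ◁ S.rHatSeq ℳ) ▷ d) ≫
    (downTau S.U (S.bU N) n W d).hom ≫
    ((S.ptInv ≫ S.hSeq ℳ) ⊗ₘ (x ⊗ₘ (S.gSeq ℳ ≫ S.pt))) ≫
    (outerSwap W ((𝟙_ C ⊗ (S.bU N ⊗ n)) ⊗ d) S.U).hom ≫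
    (downTau S.U (S.bU N) n W d).inv ≫
    (((S.U ⊗ S.bU N) ◁ S.bangHatSeq ℳ) ▷ d)

/-- the lower layer of the `↓`-rule -/
def downLower (Δ : List (Form At .pos)) (ℳ : List (Form At .neg)) (N : Form At .neg)
    (x : iface S.asgOne Δ (N :: ℳ) none ⟶ iface S.asgOne Δ (N :: ℳ) none) :
    iface S.asgOne Δ ℳ (some (.down N)) ⟶ iface S.asgOne Δ ℳ (some (.down N)) :=
  let d := cutObj S.asgOne Δ
  let n := negObj S.asgOne ℳ
  let x' : (𝟙_ C ⊗ (𝟙_ C ⊗ n)) ⊗ d ⟶ (𝟙_ C ⊗ (𝟙_ C ⊗ n)) ⊗ d :=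
    ((𝟙_ C ◁ ((0 : 𝟙_ C ⟶ S.oneObj N) ▷ n)) ▷ d) ≫ x ≫
      ((𝟙_ C ◁ ((0 : S.oneObj N ⟶ 𝟙_ C) ▷ n)) ▷ d)
  (((ρ_ S.one).inv ⊗ₘ S.rPowSeq ℳ) ▷ d) ≫
    (downTau S.one (𝟙_ C) n n d).hom ≫
    (S.hSeq ℳ ⊗ₘ (x' ⊗ₘ S.gSeq ℳ)) ≫
    (outerSwap n ((𝟙_ C ⊗ (𝟙_ C ⊗ n)) ⊗ d) S.one).hom ≫
    (downTau S.one (𝟙_ C) n n d).inv ≫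
    (((ρ_ S.one).hom ⊗ₘ S.bangPowSeq ℳ) ▷ d)

/-- the upper layer of the `↑`-rule -/
def upUpper (Δ : List (Form At .pos)) (ℳ : List (Form At .neg)) (P : Form At .pos)
    (x : iface S.asgB Δ ℳ (some P) ⟶ iface S.asgB Δ ℳ (some P)) :
    iface S.asgB Δ (.up P :: ℳ) none ⟶ iface S.asgB Δ (.up P :: ℳ) none :=
  (upTau (S.bU P) S.U (negObj S.asgB ℳ) (cutObj S.asgB Δ)).hom ≫
    ((0 : S.U ⟶ S.U) ⊗ₘ x) ≫
    (upTau (S.bU P) S.U (negObj S.asgB ℳ) (cutObj S.asgB Δ)).inv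

/-- the lower layer of the `↑`-rule -/
def upLower (Δ : List (Form At .pos)) (ℳ : List (Form At .neg)) (P : Form At .pos)
    (x : iface S.asgOne Δ ℳ (some P) ⟶ iface S.asgOne Δ ℳ (some P)) :
    iface S.asgOne Δ (.up P :: ℳ) none ⟶ iface S.asgOne Δ (.up P :: ℳ) none :=
  let d := cutObj S.asgOne Δ
  let n := negObj S.asgOne ℳ
  let x' : (𝟙_ C ⊗ n) ⊗ d ⟶ (𝟙_ C ⊗ n) ⊗ d :=
    (((0 : 𝟙_ C ⟶ S.oneObj P) ▷ n) ▷ d) ≫ x ≫ (((0 : S.oneObj P ⟶ 𝟙_ C) ▷ n) ▷ d)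
  ((𝟙_ C ◁ ((λ_ S.one).inv ▷ n)) ▷ d) ≫
    (upTau (𝟙_ C) S.one n d).hom ≫
    ((0 : S.one ⟶ S.one) ⊗ₘ x') ≫
    (upTau (𝟙_ C) S.one n d).inv ≫
    ((𝟙_ C ◁ ((λ_ S.one).hom ▷ n)) ▷ d)

/-- the symmetry `s` on `𝟙_P ⊗ 𝟙_{P^⊥}`, through `𝟙_P ≅ 𝟙_{P^⊥}` -/
def symOne (P : Form At .pos) :
    S.oneObj P ⊗ S.oneObj P.dual ⟶ S.oneObj P ⊗ S.oneObj P.dual :=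
  ((S.dualIso P).hom ⊗ₘ (S.dualIso P).inv) ≫ (β_ (S.oneObj P.dual) (S.oneObj P)).hom

/-- the upper interpretation `⟦π⟧` -/
def upper : {Δ : List (Form At .pos)} → {𝒩 : List (Form At .neg)} → {Θ : Option (Form At .pos)} →
    Proof Δ 𝒩 Θ → (iface S.asgU Δ 𝒩 Θ ⟶ iface S.asgU Δ 𝒩 Θ)
  | _, _, _, .ax _ => (axTau S.U S.U).hom ≫ (β_ S.U S.U).hom ≫ (axTau S.U S.U).inv
  | _, _, _, .exch (Δ := Δ) (Θ := Θ) e π =>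
      (exchIface S.asgU Δ e Θ).hom ≫ upper π ≫ (exchIface S.asgU Δ e Θ).inv
  | _, _, _, .cut (Δ' := Δ') (Δ'' := Δ'') (𝒩 := 𝒩) (Ξ := Ξ) (Θ := Θ) (P := P) π' π'' =>
      (cutIface S.asgU Δ' Δ'' 𝒩 Ξ Θ P).hom ≫ (upper π' ⊗ₘ upper π'') ≫
        (cutIface S.asgU Δ' Δ'' 𝒩 Ξ Θ P).inv
  | _, _, _, .tensor (Δ' := Δ') (Δ'' := Δ'') (ℳ := ℳ) (𝒩 := 𝒩) (P := P) (Q := Q) π' π'' =>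
      S.undagger (Δ' ++ Δ'') (ℳ ++ 𝒩) (some (.tensor P Q))
        ((tensorIface S.asgB Δ' Δ'' ℳ 𝒩 P Q).hom ≫
          (S.dagger Δ' ℳ (some P) (upper π') ⊗ₘ S.dagger Δ'' 𝒩 (some Q) (upper π'')) ≫
          (tensorIface S.asgB Δ' Δ'' ℳ 𝒩 P Q).inv)
  | _, _, _, .par (Δ := Δ) (𝒩 := 𝒩) (Θ := Θ) (N := N) (M := M) π =>
      S.undagger Δ (.par N M :: 𝒩) Θ
        ((parTau (posObj S.asgB Θ) (S.bU N) (S.bU M) (negObj S.asgB 𝒩) (cutObj S.asgB Δ)).hom ≫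
          S.dagger Δ (N :: M :: 𝒩) Θ (upper π) ≫
          (parTau (posObj S.asgB Θ) (S.bU N) (S.bU M) (negObj S.asgB 𝒩) (cutObj S.asgB Δ)).inv)
  | _, _, _, .down (Δ := Δ) (ℳ := ℳ) (N := N) π =>
      S.undagger Δ ℳ (some (.down N)) (S.downUpper Δ ℳ N (S.dagger Δ (N :: ℳ) none (upper π)))
  | _, _, _, .up (Δ := Δ) (ℳ := ℳ) (P := P) π =>
      S.undagger Δ (.up P :: ℳ) none (S.upUpper Δ ℳ P (S.dagger Δ ℳ (some P) (upper π)))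

/-- the lower interpretation `f_π` -/
def lower : {Δ : List (Form At .pos)} → {𝒩 : List (Form At .neg)} → {Θ : Option (Form At .pos)} →
    Proof Δ 𝒩 Θ → (iface S.asgOne Δ 𝒩 Θ ⟶ iface S.asgOne Δ 𝒩 Θ)
  | _, _, _, .ax P => (axTau (S.oneObj P) (S.oneObj P.dual)).hom ≫ S.symOne P ≫
      (axTau (S.oneObj P) (S.oneObj P.dual)).inv
  | _, _, _, .exch (Δ := Δ) (Θ := Θ) e π =>
      (exchIface S.asgOne Δ e Θ).hom ≫ lower π ≫ (exchIface S.asgOne Δ e Θ).inv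
  | _, _, _, .cut (Δ' := Δ') (Δ'' := Δ'') (𝒩 := 𝒩) (Ξ := Ξ) (Θ := Θ) (P := P) π' π'' =>
      (cutIface S.asgOne Δ' Δ'' 𝒩 Ξ Θ P).hom ≫ (lower π' ⊗ₘ lower π'') ≫
        (cutIface S.asgOne Δ' Δ'' 𝒩 Ξ Θ P).inv
  | _, _, _, .tensor (Δ' := Δ') (Δ'' := Δ'') (ℳ := ℳ) (𝒩 := 𝒩) (P := P) (Q := Q) π' π'' =>
      (tensorIface S.asgOne Δ' Δ'' ℳ 𝒩 P Q).hom ≫ (lower π' ⊗ₘ lower π'') ≫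
        (tensorIface S.asgOne Δ' Δ'' ℳ 𝒩 P Q).inv
  | _, _, _, .par (Δ := Δ) (𝒩 := 𝒩) (Θ := Θ) (N := N) (M := M) π =>
      (parTau (posObj S.asgOne Θ) (S.oneObj N) (S.oneObj M) (negObj S.asgOne 𝒩)
        (cutObj S.asgOne Δ)).hom ≫ lower π ≫
      (parTau (posObj S.asgOne Θ) (S.oneObj N) (S.oneObj M) (negObj S.asgOne 𝒩)
        (cutObj S.asgOne Δ)).inv
  | _, _, _, .down (Δ := Δ) (ℳ := ℳ) (N := N) π => S.downLower Δ ℳ N (lower π)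
  | _, _, _, .up (Δ := Δ) (ℳ := ℳ) (P := P) π => S.upLower Δ ℳ P (lower π)

/-- `σ`: the tensor product of the symmetries `s_{U,U}` over the pairs of cut formulas -/
def sigma : ∀ Δ : List (Form At .pos), cutObj S.asgU Δ ⟶ cutObj S.asgU Δ
  | [] => 𝟙 (𝟙_ C)
  | _ :: Δ => (β_ S.U S.U).hom ⊗ₘ sigma Δ

/-- `σ_*`: the tensor product of the symmetries on `𝟙_P ⊗ 𝟙_{P^⊥}` over the pairs of cut formulas -/
def sigmaStar : ∀ Δ : List (Form At .pos), cutObj S.asgOne Δ ⟶ cutObj S.asgOne Δ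
  | [] => 𝟙 (𝟙_ C)
  | P :: Δ => S.symOne P ⊗ₘ sigmaStar Δ

variable {Δ : List (Form At .pos)} {𝒩 : List (Form At .neg)} {Θ : Option (Form At .pos)}

/-- the upper execution formula `Ex(⟦π⟧, σ)` -/
def exUpper (π : Proof Δ 𝒩 Θ) : conclObj S.asgU 𝒩 Θ ⟶ conclObj S.asgU 𝒩 Θ :=
  TracedCategory.tr (cutObj S.asgU Δ) (S.upper π ≫ conclObj S.asgU 𝒩 Θ ◁ S.sigma Δ)

/-- the lower execution formula `Ex(f_π, σ_*)` -/
def exLower (π : Proof Δ 𝒩 Θ) : conclObj S.asgOne 𝒩 Θ ⟶ conclObj S.asgOne 𝒩 Θ :=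
  TracedCategory.tr (cutObj S.asgOne Δ) (S.lower π ≫ conclObj S.asgOne 𝒩 Θ ◁ S.sigmaStar Δ)

/-- the multipoint `mp(𝒩) : 𝟙_𝒩 ⟶ U_𝒩` of a sequence -/
def mpSeq (𝒩 : List (Form At .neg)) : negObj S.asgOne 𝒩 ⟶ negObj S.asgU 𝒩 :=
  negMap (F := S.asgOne) (G := S.asgU) (fun _ A => S.mp A) 𝒩

/-- `mp(P)` as a morphism `𝟙_P ⟶ U_P ⊗ U_𝒩` -/
def mpPos (𝒩 : List (Form At .neg)) (P : Form At .pos) :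
    S.oneObj P ⟶ conclObj S.asgU 𝒩 (some P) :=
  S.mp P ≫ quasiInl S.U (negObj S.asgU 𝒩)

/-- `mp(𝒩)` as a morphism `𝟙_𝒩 ⟶ U_P ⊗ U_𝒩` -/
def mpNeg (𝒩 : List (Form At .neg)) (P : Form At .pos) :
    negObj S.asgOne 𝒩 ⟶ conclObj S.asgU 𝒩 (some P) :=
  S.mpSeq 𝒩 ≫ quasiInr S.U (negObj S.asgU 𝒩)

/-- the restriction of `Ex(f_π, σ_*)` to `𝟙_P` -/
def exLowerRestrict {P : Form At .pos} (π : Proof Δ 𝒩 (some P)) :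
    S.oneObj P ⟶ S.oneObj P ⊗ negObj S.asgOne 𝒩 :=
  quasiInl (S.oneObj P) (negObj S.asgOne 𝒩) ≫ S.exLower π

end PolarizedGoI

end

/-! A single morphism g : 1_P ⟶ 1_𝒩 governs both layers. In the lower layer, an input at P with zero
on 𝒩 comes out as g on 𝒩 with zero on P; in the upper layer, the input mp(P) comes out as g followed
by mp(𝒩), again with zero on P. Both assertions of the theorem follow from the existence of g, which
is proved by induction on the proof (`focusedLayers`).

The two layers are instances of one predicate, `Focused`, relative to a family of points 𝟙_A ⟶ F A:
identities below, multipoints above, and unfolded multipoints on the objects 𝐔_A in between. The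
predicate quantifies over all `CutTwist`s and not over σ alone: sliding foldings and unfoldings
around the trace replaces σ by another endomorphism, of which only one property matters, namely that
it sends the point of a negative cut formula to the point of its dual.

Axiom: dual formulas have the same multipoint (`dualIso_hom_mp`), since the multipoint of a shift
does not see the formula under the shift. Rule ↓ (`Focused.down`): the premise receives only zeros
and drops out; the point α is undone by α^*, travels through h_m, and is absorbed by !̂ into the
multipoint of the context (`quasiInr_bangHatSeq`). Rules ⊗, ⅋ and exchange only rearrange factors.

Cut (`tr_cut`): uniformity applied to the zero point yields `ZeroUniform`: if zero fed into the
feedback wire comes back as zero, then the trace is the remaining output, up to a zero scalar. The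
loop is opened at P^⊥. With zero entering there, the right premise answers on its negative formulas;
its answer at P^⊥ becomes the point of P; the left premise answers on its context and leaves zero at
P, so zero returns to the wire.

The permutations of factors are compared by a coherence theorem for structural morphisms that may
also contain zero morphisms out of the unit (`Structural.unique`). -/

noncomputable section

/-! ### Coherence for symmetric monoidal categories with zero morphisms -/

namespace SymmCoherence

variable {C : Type u} [Category.{v} C] [MonoidalCategory C]

/-- Formal tensor products of atoms. -/
inductive Tree : Type
  | unit : Tree
  | leaf (i : ℕ) : Tree
  | tens (s t : Tree) : Tree

/-- The tensor product of a list of atoms. -/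
@[reducible] def lprod (E : ℕ → C) : List ℕ → C
  | [] => 𝟙_ C
  | a :: l => E a ⊗ lprod E l

@[reducible] def Tree.ev (E : ℕ → C) : Tree → C
  | .unit => 𝟙_ C
  | .leaf i => E i
  | .tens s t => s.ev E ⊗ t.ev E

/-- The leaves of a tree, put in front of a list. -/
@[reducible] def Tree.act : Tree → List ℕ → List ℕ
  | .unit, l => l
  | .leaf i, l => i :: l
  | .tens s t, l => s.act (t.act l)

/-- The normalization of a formal tensor product. -/
def Tree.norm (E : ℕ → C) : ∀ (s : Tree) (l : List ℕ), s.ev E ⊗ lprod E l ≅ lprod E (s.act l)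
  | .unit, l => λ_ (lprod E l)
  | .leaf i, l => Iso.refl (E i ⊗ lprod E l)
  | .tens s t, l => α_ (s.ev E) (t.ev E) (lprod E l) ≪≫
      (Iso.refl (s.ev E) ⊗ᵢ t.norm E l) ≪≫ s.norm E (t.act l)

theorem Tree.act_eq_append (s : Tree) (l : List ℕ) : s.act l = s.act [] ++ l := by
  induction s generalizing l with
  | unit => rfl
  | leaf i => rfl
  | tens s t hs ht =>
    simp only [Tree.act]
    rw [hs, ht, hs (t.act []), List.append_assoc]

theorem zero_unit_tensor [Limits.HasZeroMorphisms C] (X Y : C) :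
    (0 : 𝟙_ C ⟶ X ⊗ Y) = (λ_ (𝟙_ C)).inv ≫ ((0 : 𝟙_ C ⟶ X) ⊗ₘ (0 : 𝟙_ C ⟶ Y)) := by
  rw [MonoidalCategory.tensorHom_def, unitors_inv_equal, ← rightUnitor_inv_naturality_assoc]
  simp

variable [SymmetricCategory C]

theorem leftComm_naturality {X X' Y Y' Z Z' : C} (f : X ⟶ X') (g : Y ⟶ Y') (h : Z ⟶ Z') :
    (f ⊗ₘ (g ⊗ₘ h)) ≫ (leftComm X' Y' Z').hom = (leftComm X Y Z).hom ≫ (g ⊗ₘ (f ⊗ₘ h)) := by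
  simp only [leftComm, Iso.trans_hom, Iso.symm_hom, MonoidalCategory.tensorIso_hom, Iso.refl_hom,
    Category.assoc, associator_inv_naturality_assoc, tensorHom_id, ← associator_naturality]
  rw [← tensorHom_id, ← tensorHom_id, tensorHom_comp_tensorHom_assoc,
    tensorHom_comp_tensorHom_assoc, BraidedCategory.braiding_naturality]
  simp

theorem leftComm_naturality_right (X Y : C) {Z Z' : C} (h : Z ⟶ Z') :
    X ◁ Y ◁ h ≫ (leftComm X Y Z').hom = (leftComm X Y Z).hom ≫ Y ◁ X ◁ h := by
  simpa using leftComm_naturality (𝟙 X) (𝟙 Y) h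

theorem leftComm_leftComm (X Y Z : C) :
    (leftComm X Y Z).hom ≫ (leftComm Y X Z).hom = 𝟙 _ := by
  simp [leftComm, ← comp_whiskerRight_assoc]

/-- Yang–Baxter for the first three factors; it is the step case of `Extract.diamond`. -/
theorem leftComm_braid (X Y Z W : C) :
    X ◁ (leftComm Y Z W).hom ≫ (leftComm X Z (Y ⊗ W)).hom ≫ Z ◁ (leftComm X Y W).hom =
      (leftComm X Y (Z ⊗ W)).hom ≫ Y ◁ (leftComm X Z W).hom ≫ (leftComm Y Z (X ⊗ W)).hom := by
  trans 𝟙 (X ⊗ Y ⊗ Z ⊗ W) ⊗≫ (𝟙 ((X ⊗ Y) ⊗ Z) ⊗≫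
      (X ◁ (β_ Y Z).hom ⊗≫ (β_ X Z).hom ▷ Y ⊗≫ Z ◁ (β_ X Y).hom) ⊗≫ 𝟙 ((Z ⊗ Y) ⊗ X)) ▷ W ⊗≫ 𝟙 (Z ⊗ Y ⊗ X ⊗ W)
  · simp only [leftComm, Iso.trans_hom, Iso.symm_hom, MonoidalCategory.tensorIso_hom, Iso.refl_hom,
      tensorHom_id]
    monoidal
  · rw [← BraidedCategory.yang_baxter']
    simp only [leftComm, Iso.trans_hom, Iso.symm_hom, MonoidalCategory.tensorIso_hom, Iso.refl_hom,
      tensorHom_id]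
    monoidal

variable [Limits.HasZeroMorphisms C] (E : ℕ → C)

/-- Extraction of the first occurrence of `a`, which is created by a zero morphism if there is
none. -/
inductive Extract (a : ℕ) : ∀ l l' : List ℕ, (lprod E l ⟶ E a ⊗ lprod E l') → Prop
  | nil : Extract a [] [] ((λ_ (𝟙_ C)).inv ≫ (0 : 𝟙_ C ⟶ E a) ▷ 𝟙_ C)
  | here (l : List ℕ) : Extract a (a :: l) l (𝟙 _)
  | there {c : ℕ} {l l' : List ℕ} {f} (hc : c ≠ a) (h : Extract a l l' f) :
      Extract a (c :: l) (c :: l') (E c ◁ f ≫ (leftComm (E c) (E a) (lprod E l')).hom)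

/-- The canonical morphisms between products of lists. -/
inductive Canon : ∀ l l' : List ℕ, (lprod E l ⟶ lprod E l') → Prop
  | nil : Canon [] [] (𝟙 _)
  | cons {a : ℕ} {l l' L : List ℕ} {f g} (h : Extract E a l l' f) (h' : Canon l' L g) :
      Canon l (a :: L) (f ≫ E a ◁ g)

theorem zero_leftComm (X Y : C) :
    ((λ_ (𝟙_ C)).inv ≫ (0 : 𝟙_ C ⟶ X) ▷ 𝟙_ C) ≫
        X ◁ ((λ_ (𝟙_ C)).inv ≫ (0 : 𝟙_ C ⟶ Y) ▷ 𝟙_ C) ≫ (leftComm X Y (𝟙_ C)).hom =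
      ((λ_ (𝟙_ C)).inv ≫ (0 : 𝟙_ C ⟶ Y) ▷ 𝟙_ C) ≫
        Y ◁ ((λ_ (𝟙_ C)).inv ≫ (0 : 𝟙_ C ⟶ X) ▷ 𝟙_ C) := by
  have := leftComm_naturality (0 : 𝟙_ C ⟶ X) (0 : 𝟙_ C ⟶ Y) (𝟙 (𝟙_ C))
  have h2 : ∀ A B : C, ((λ_ (𝟙_ C)).inv ≫ (0 : 𝟙_ C ⟶ A) ▷ 𝟙_ C) ≫
        A ◁ ((λ_ (𝟙_ C)).inv ≫ (0 : 𝟙_ C ⟶ B) ▷ 𝟙_ C) =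
      (λ_ (𝟙_ C)).inv ≫ 𝟙_ C ◁ (λ_ (𝟙_ C)).inv ≫
        ((0 : 𝟙_ C ⟶ A) ⊗ₘ ((0 : 𝟙_ C ⟶ B) ⊗ₘ 𝟙 (𝟙_ C))) := by
    intro A B
    simp [tensorHom_def']
  rw [← Category.assoc, h2, h2, Category.assoc, Category.assoc, this]
  have h3 : 𝟙_ C ◁ (λ_ (𝟙_ C)).inv ≫ (leftComm (𝟙_ C) (𝟙_ C) (𝟙_ C)).hom =
      𝟙_ C ◁ (λ_ (𝟙_ C)).inv := by
    simp [leftComm]; monoidal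
  rw [reassoc_of% h3]

variable {E}

/-- Extractions of two different atoms commute. If both are absent, this is the symmetry of two
created zeros (`zero_leftComm`); if one is at the head, the two swaps cancel or nothing happens;
below another head it is the braid relation. -/
theorem Extract.diamond {a b : ℕ} (hab : a ≠ b) {l l₁ : List ℕ} {f} (h : Extract E b l l₁ f) :
    ∀ {l₁₂ : List ℕ} {g}, Extract E a l₁ l₁₂ g → ∃ (l₂ : List ℕ) (f' : _) (g' : _),
      Extract E a l l₂ f' ∧ Extract E b l₂ l₁₂ g' ∧
      f ≫ E b ◁ g ≫ (leftComm (E b) (E a) (lprod E l₁₂)).hom = f' ≫ E a ◁ g' := by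
  induction h with
  | nil =>
    intro l₁₂ g hg
    cases hg
    exact ⟨[], _, _, .nil, .nil, zero_leftComm _ _⟩
  | here l =>
    intro l₁₂ g hg
    exact ⟨_, _, _, .there hab.symm hg, .here _, by simp⟩
  | @there c l l' f hc h ih =>
    intro l₁₂ g hg
    cases hg with
    | here =>
      refine ⟨_, _, _, .here _, h, ?_⟩
      simp [leftComm_leftComm]
    | @there _ _ l₁₂ g hca hg =>
      obtain ⟨l₂, f', g', h₁, h₂, e⟩ := ih hg
      refine ⟨_, _, _, .there hca h₁, .there hc h₂, ?_⟩
      have e' := congrArg (fun k => E c ◁ k) e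
      simp only [whiskerLeft_comp, Category.assoc] at e' ⊢
      have n₁ := leftComm_naturality_right (E c) (E b) g
      have n₂ := leftComm_naturality_right (E c) (E a) g'
      rw [← reassoc_of% n₁, ← reassoc_of% n₂, ← reassoc_of% e', leftComm_braid]

/-- An extraction after a canonical morphism can be moved in front of it. This is what makes
canonical morphisms closed under composition. -/
theorem Canon.extract {a : ℕ} {l L : List ℕ} {f} (h : Canon E l L f) :
    ∀ {L' : List ℕ} {m}, Extract E a L L' m → ∃ (l' : List ℕ) (m' : _) (f' : _),
      Extract E a l l' m' ∧ Canon E l' L' f' ∧ f ≫ m = m' ≫ E a ◁ f' := by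
  induction h with
  | nil =>
    intro L' m hm
    cases hm
    exact ⟨_, _, _, .nil, .nil, by simp⟩
  | @cons b l l' L f g h h' ih =>
    intro L' m hm
    cases hm with
    | here => exact ⟨_, _, _, h, h', by simp⟩
    | @there _ _ L' m hba hm =>
      obtain ⟨l'', m', f', h₁, h₂, e⟩ := ih hm
      obtain ⟨l₂, n, n', h₃, h₄, e'⟩ := Extract.diamond hba.symm h h₁
      refine ⟨_, _, _, h₃, .cons h₄ h₂, ?_⟩
      have e₁ := congrArg (fun k => E b ◁ k) e
      simp only [whiskerLeft_comp, Category.assoc] at e₁ e' ⊢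
      have n₁ := leftComm_naturality_right (E b) (E a) f'
      rw [reassoc_of% e₁, n₁, reassoc_of% e']

theorem Canon.comp {l L K : List ℕ} {f g} (hf : Canon E l L f) (hg : Canon E L K g) :
    Canon E l K (f ≫ g) := by
  induction hg generalizing l with
  | nil => simpa using hf
  | @cons b l₁ l' L f g h h' ih =>
    obtain ⟨l₂, m, k, h₁, h₂, e⟩ := hf.extract h
    have := Canon.cons h₁ (ih h₂)
    rwa [whiskerLeft_comp, ← reassoc_of% e] at this

theorem Canon.whiskerLeft {l L : List ℕ} {f} (h : Canon E l L f) (a : ℕ) :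
    Canon E (a :: l) (a :: L) (E a ◁ f) := by
  simpa using Canon.cons (Extract.here l) h

theorem Canon.refl (l : List ℕ) : Canon E l l (𝟙 _) := by
  induction l with
  | nil => exact .nil
  | cons a l ih => simpa using ih.whiskerLeft a

theorem Canon.swap {a b : ℕ} (h : b ≠ a) (l : List ℕ) :
    Canon E (b :: a :: l) (a :: b :: l) (leftComm (E b) (E a) (lprod E l)).hom := by
  simpa using Canon.cons (.there h (.here l)) (Canon.refl (E := E) (b :: l))

/-- The zero is created at the far end of the list and then swapped to the front; by naturality it
may as well be created there. -/
theorem Extract.of_notMem {a : ℕ} {l : List ℕ} (h : a ∉ l) :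
    Extract E a l l ((λ_ (lprod E l)).inv ≫ (0 : 𝟙_ C ⟶ E a) ▷ lprod E l) := by
  induction l with
  | nil => exact .nil
  | cons c l ih =>
    simp only [List.mem_cons, not_or] at h
    have := Extract.there (E := E) (Ne.symm h.1) (ih h.2)
    convert this using 1
    have n := leftComm_naturality (𝟙 (E c)) (0 : 𝟙_ C ⟶ E a) (𝟙 (lprod E l))
    simp only [id_tensorHom, tensorHom_id, id_whiskerRight] at n
    simp only [whiskerLeft_comp, Category.assoc, n]
    simp [leftComm]

theorem Extract.unique {a : ℕ} {l l' : List ℕ} {f} (h : Extract E a l l' f) :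
    ∀ {l'' : List ℕ} {f'}, Extract E a l l'' f' →
      (⟨l', f⟩ : Σ k, lprod E l ⟶ E a ⊗ lprod E k) = ⟨l'', f'⟩ := by
  induction h with
  | nil => intro l'' f' h'; cases h'; rfl
  | here l =>
    intro l'' f' h'
    cases h' with
    | here => rfl
    | there hc => exact absurd rfl hc
  | there hc h ih =>
    intro l'' f' h'
    cases h' with
    | here => exact absurd rfl hc
    | there _ h' => cases ih h'; rfl

/-- Extraction is deterministic, so the target list dictates every step. -/
theorem Canon.unique {l L : List ℕ} {f} (h : Canon E l L f) :
    ∀ {f'}, Canon E l L f' → f = f' := by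
  induction h with
  | nil => intro f' h'; cases h'; rfl
  | cons h _ ih =>
    intro f' h'
    cases h' with
    | cons h₁ h₂ =>
      cases h.unique h₁
      rw [ih h₂]

theorem Extract.subset {a : ℕ} {l l' : List ℕ} {f} (h : Extract E a l l' f) (h' : l'.Nodup)
    (ha : a ∉ l') : l.Nodup ∧ l ⊆ a :: l' := by
  induction h with
  | nil => simp
  | here l => simp_all
  | there hc h ih =>
    simp only [List.nodup_cons, List.mem_cons, not_or] at h' ha ⊢
    obtain ⟨h₁, h₂⟩ := ih h'.2 ha.2
    refine ⟨⟨fun hm => ?_, h₁⟩, ?_⟩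
    · have := h₂ hm
      simp_all
    · intro x hx
      have := @h₂ x
      simp_all
      grind

/-- Atoms can be created but never lost, so distinctness passes from target to source. In a
composite it therefore has to be assumed only at the last target. -/
theorem Canon.nodup {l L : List ℕ} {f} (h : Canon E l L f) (hL : L.Nodup) :
    l.Nodup ∧ l ⊆ L := by
  induction h with
  | nil => simp
  | @cons a l l' L f g h h' ih =>
    simp only [List.nodup_cons] at hL
    obtain ⟨h₁, h₂⟩ := ih hL.2
    obtain ⟨h₃, h₄⟩ := h.subset h₁ fun hm => hL.1 (h₂ hm)
    exact ⟨h₃, List.Subset.trans h₄ (List.cons_subset_cons _ h₂)⟩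

theorem Canon.act {l L : List ℕ} {f} (h : Canon E l L f) (s : Tree) :
    Canon E (s.act l) (s.act L) ((s.norm E l).inv ≫ s.ev E ◁ f ≫ (s.norm E L).hom) := by
  induction s generalizing l L with
  | unit => simpa [Tree.norm] using h
  | leaf i => simpa [Tree.norm] using h.whiskerLeft i
  | tens s t hs ht =>
    have := hs (ht h)
    simpa [Tree.norm] using this

variable (E)

/-- `s` denotes the object `X`. -/
class Denotes (X : C) (s : outParam Tree) : Prop where
  eq : s.ev E = X

/-- `f` is composed of structural isomorphisms and zero morphisms out of the unit. -/
class Structural {X Y : C} (f : X ⟶ Y) (s t : outParam Tree) : Prop where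
  src : s.ev E = X
  tgt : t.ev E = Y
  canon : ∀ l, (t.act l).Nodup → Canon E (s.act l) (t.act l)
    ((s.norm E l).inv ≫ (eqToHom src ≫ f ≫ eqToHom tgt.symm) ▷ lprod E l ≫ (t.norm E l).hom)

variable {E}

theorem Structural.mk' {s t : Tree} {f : s.ev E ⟶ t.ev E}
    (h : ∀ l, (t.act l).Nodup → Canon E (s.act l) (t.act l)
      ((s.norm E l).inv ≫ f ▷ lprod E l ≫ (t.norm E l).hom)) : Structural E f s t :=
  ⟨rfl, rfl, fun l hl => by simpa using h l hl⟩

theorem Structural.canon' {s t : Tree} {f : s.ev E ⟶ t.ev E} (h : Structural E f s t) (l : List ℕ)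
    (hl : (t.act l).Nodup) : Canon E (s.act l) (t.act l)
      ((s.norm E l).inv ≫ f ▷ lprod E l ≫ (t.norm E l).hom) := by
  simpa using h.canon l hl

/-- Coherence: structural morphisms between products of distinct atoms are determined by their
source and target. -/
theorem Structural.unique {X Y : C} {f g : X ⟶ Y} {s t : Tree} (E : ℕ → C) [hf : Structural E f s t]
    [hg : Structural E g s t] (ht : (t.act []).Nodup) : f = g := by
  obtain rfl := hf.src
  obtain rfl := hf.tgt
  have := (hf.canon' [] ht).unique (hg.canon' [] ht)
  simpa using this

instance : Denotes E (𝟙_ C) .unit := ⟨rfl⟩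

instance {X Y : C} {s t : Tree} [hX : Denotes E X s] [hY : Denotes E Y t] :
    Denotes E (X ⊗ Y) (.tens s t) := ⟨by rw [← hX.eq, ← hY.eq]⟩

instance {X : C} {s : Tree} [hX : Denotes E X s] : Structural E (𝟙 X) s s := by
  obtain rfl := hX.eq
  exact .mk' fun l _ => by simpa using Canon.refl _

instance {X Y Z : C} {f : X ⟶ Y} {g : Y ⟶ Z} {s t u : Tree} [hf : Structural E f s t]
    [hg : Structural E g t u] : Structural E (f ≫ g) s u := by
  obtain rfl := hf.src
  obtain rfl := hf.tgt
  obtain rfl := hg.tgt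
  refine .mk' fun l hl => ?_
  have h₁ := hg.canon' l hl
  simpa using (hf.canon' l (h₁.nodup hl).1).comp h₁

instance whiskerLeft_structural {X Y Z : C} {f : Y ⟶ Z} {s t u : Tree} [hX : Denotes E X u]
    [hf : Structural E f s t] : Structural E (X ◁ f) (.tens u s) (.tens u t) := by
  obtain rfl := hX.eq
  obtain rfl := hf.src
  obtain rfl := hf.tgt
  refine .mk' (s := .tens u s) (t := .tens u t) fun l hl => ?_
  have hl' : (t.act l).Nodup := by
    simp only [Tree.act] at hl
    rw [Tree.act_eq_append] at hl
    exact hl.of_append_right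
  simpa [Tree.norm] using (hf.canon' l hl').act u

/-- The tail list `l` in `Structural` serves this case: the right factor is merged into the tail. -/
instance whiskerRight_structural {X Y Z : C} {f : Y ⟶ Z} {s t u : Tree} [hX : Denotes E X u]
    [hf : Structural E f s t] : Structural E (f ▷ X) (.tens s u) (.tens t u) := by
  obtain rfl := hX.eq
  obtain rfl := hf.src
  obtain rfl := hf.tgt
  refine .mk' (s := .tens s u) (t := .tens t u) fun l hl => ?_
  have := hf.canon' (u.act l) hl
  convert this using 1
  have e := whisker_exchange (f : s.ev E ⟶ t.ev E) (u.norm E l).hom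
  simp only [Tree.norm, Iso.trans_hom, Iso.trans_inv, MonoidalCategory.tensorIso_hom,
    MonoidalCategory.tensorIso_inv, Iso.refl_hom, Iso.refl_inv, id_tensorHom, Category.assoc,
    Iso.cancel_iso_inv_left]
  rw [associator_naturality_left_assoc, Iso.inv_hom_id_assoc, ← reassoc_of% e]
  simp

instance tensorHom_structural {X Y Z W : C} {f : X ⟶ Y} {g : Z ⟶ W} {s t u v : Tree}
    [hf : Structural E f s t] [hg : Structural E g u v] :
    Structural E (f ⊗ₘ g) (.tens s u) (.tens t v) := by
  have : Denotes E Z u := ⟨hg.src⟩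
  have : Denotes E Y t := ⟨hf.tgt⟩
  rw [MonoidalCategory.tensorHom_def]
  infer_instance

instance associator_structural {X Y Z : C} {s t u : Tree} [hX : Denotes E X s]
    [hY : Denotes E Y t] [hZ : Denotes E Z u] :
    Structural E (α_ X Y Z).hom (.tens (.tens s t) u) (.tens s (.tens t u)) := by
  obtain rfl := hX.eq
  obtain rfl := hY.eq
  obtain rfl := hZ.eq
  refine .mk' (s := .tens (.tens s t) u) (t := .tens s (.tens t u)) fun l hl => ?_
  convert Canon.refl (E := E) (s.act (t.act (u.act l))) using 1
  rw [Iso.inv_comp_eq]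
  simp [Tree.norm]

instance associator_inv_structural {X Y Z : C} {s t u : Tree} [hX : Denotes E X s]
    [hY : Denotes E Y t] [hZ : Denotes E Z u] :
    Structural E (α_ X Y Z).inv (.tens s (.tens t u)) (.tens (.tens s t) u) := by
  obtain rfl := hX.eq
  obtain rfl := hY.eq
  obtain rfl := hZ.eq
  refine .mk' (s := .tens s (.tens t u)) (t := .tens (.tens s t) u) fun l hl => ?_
  convert Canon.refl (E := E) (s.act (t.act (u.act l))) using 1
  rw [Iso.inv_comp_eq]
  simp [Tree.norm]

instance leftUnitor_structural {X : C} {s : Tree} [hX : Denotes E X s] :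
    Structural E (λ_ X).hom (.tens .unit s) s := by
  obtain rfl := hX.eq
  refine .mk' (s := .tens .unit s) (t := s) fun l hl => ?_
  convert Canon.refl (E := E) (s.act l) using 1
  simp [Tree.norm]

instance leftUnitor_inv_structural {X : C} {s : Tree} [hX : Denotes E X s] :
    Structural E (λ_ X).inv s (.tens .unit s) := by
  obtain rfl := hX.eq
  refine .mk' (s := s) (t := .tens .unit s) fun l hl => ?_
  convert Canon.refl (E := E) (s.act l) using 1
  simp [Tree.norm]

instance rightUnitor_structural {X : C} {s : Tree} [hX : Denotes E X s] :
    Structural E (ρ_ X).hom (.tens s .unit) s := by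
  obtain rfl := hX.eq
  refine .mk' (s := .tens s .unit) (t := s) fun l hl => ?_
  convert Canon.refl (E := E) (s.act l) using 1
  simp [Tree.norm]

instance rightUnitor_inv_structural {X : C} {s : Tree} [hX : Denotes E X s] :
    Structural E (ρ_ X).inv s (.tens s .unit) := by
  obtain rfl := hX.eq
  refine .mk' (s := s) (t := .tens s .unit) fun l hl => ?_
  convert Canon.refl (E := E) (s.act l) using 1
  simp [Tree.norm]

/-- The hexagon reduces to two leaves. These are different by the distinctness hypothesis, without
which a swap would not be canonical. -/
theorem braiding_leaf_structural (i : ℕ) (t : Tree) :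
    Structural E (β_ (E i) (t.ev E)).hom (.tens (.leaf i) t) (.tens t (.leaf i)) := by
  have (s : Tree) : Denotes E (s.ev E) s := ⟨rfl⟩
  induction t with
  | unit =>
    simp only [Tree.ev, braiding_tensorUnit_right]
    have := this (.leaf i)
    infer_instance
  | leaf j =>
    refine .mk' (s := .tens (.leaf i) (.leaf j)) (t := .tens (.leaf j) (.leaf i)) fun l hl => ?_
    simp only [Tree.act, List.nodup_cons, List.mem_cons, not_or] at hl
    convert Canon.swap (E := E) (Ne.symm hl.1.1) l using 1
    simp [Tree.norm, leftComm]
  | tens s t hs ht =>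
    simp only [Tree.ev, BraidedCategory.braiding_tensor_right_hom]
    have := this (.leaf i)
    infer_instance

instance braiding_structural {X Y : C} {s t : Tree} [hX : Denotes E X s] [hY : Denotes E Y t] :
    Structural E (β_ X Y).hom (.tens s t) (.tens t s) := by
  obtain rfl := hX.eq
  obtain rfl := hY.eq
  have (s : Tree) : Denotes E (s.ev E) s := ⟨rfl⟩
  induction s with
  | unit =>
    simp only [Tree.ev, braiding_tensorUnit_left]
    infer_instance
  | leaf j => exact braiding_leaf_structural j t
  | tens s t hs ht =>
    simp only [Tree.ev, BraidedCategory.braiding_tensor_left_hom]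
    infer_instance

instance braiding_inv_structural {X Y : C} {s t : Tree} [Denotes E X s] [Denotes E Y t] :
    Structural E (β_ X Y).inv (.tens t s) (.tens s t) := by
  rw [← SymmetricCategory.braiding_swap_eq_inv_braiding]
  infer_instance

/-- Distinctness says that the leaf is absent from the tail, so extracting it creates exactly this
zero. -/
instance zero_leaf_structural {X : C} {i : ℕ} [hX : Denotes E X (.leaf i)] :
    Structural E (0 : 𝟙_ C ⟶ X) .unit (.leaf i) := by
  obtain rfl := hX.eq
  refine .mk' (s := .unit) (t := .leaf i) fun l hl => ?_
  simp only [Tree.act, List.nodup_cons] at hl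
  simpa [Tree.norm] using Canon.cons (Extract.of_notMem (E := E) hl.1) (Canon.refl l)

instance zero_tensor_structural {X Y : C} {s t : Tree} [Structural E (0 : 𝟙_ C ⟶ X) .unit s]
    [Structural E (0 : 𝟙_ C ⟶ Y) .unit t] :
    Structural E (0 : 𝟙_ C ⟶ X ⊗ Y) .unit (.tens s t) := by
  rw [zero_unit_tensor]
  infer_instance

/-- Unit factors need their own instances, because the zero endomorphism of the unit is not assumed
to be the identity and is not treated as structural. -/
instance zero_unit_tensor_structural {X : C} {s : Tree} [h : Structural E (0 : 𝟙_ C ⟶ X) .unit s] :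
    Structural E (0 : 𝟙_ C ⟶ 𝟙_ C ⊗ X) .unit (.tens .unit s) := by
  have : Denotes E X s := ⟨h.tgt⟩
  rw [← Limits.zero_comp (f := (λ_ X).inv) (X := 𝟙_ C)]
  infer_instance

instance zero_tensor_unit_structural {X : C} {s : Tree} [h : Structural E (0 : 𝟙_ C ⟶ X) .unit s] :
    Structural E (0 : 𝟙_ C ⟶ X ⊗ 𝟙_ C) .unit (.tens s .unit) := by
  have : Denotes E X s := ⟨h.tgt⟩
  rw [← Limits.zero_comp (f := (ρ_ X).inv) (X := 𝟙_ C)]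
  infer_instance

instance quasiInl_structural {X Y : C} {s t : Tree} [Denotes E X s]
    [Structural E (0 : 𝟙_ C ⟶ Y) .unit t] : Structural E (quasiInl X Y) s (.tens s t) := by
  unfold quasiInl
  infer_instance

instance quasiInr_structural {X Y : C} {s t : Tree} [Denotes E Y t]
    [Structural E (0 : 𝟙_ C ⟶ X) .unit s] : Structural E (quasiInr X Y) t (.tens s t) := by
  unfold quasiInr
  infer_instance

/-- an environment with at most eight atoms -/
@[reducible] def atoms (X₀ X₁ X₂ X₃ X₄ X₅ X₆ X₇ : C) : ℕ → C
  | 0 => X₀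
  | 1 => X₁
  | 2 => X₂
  | 3 => X₃
  | 4 => X₄
  | 5 => X₅
  | 6 => X₆
  | _ => X₇

section

variable (X₀ X₁ X₂ X₃ X₄ X₅ X₆ X₇ : C)

instance : Denotes (atoms X₀ X₁ X₂ X₃ X₄ X₅ X₆ X₇) X₀ (.leaf 0) := ⟨rfl⟩
instance : Denotes (atoms X₀ X₁ X₂ X₃ X₄ X₅ X₆ X₇) X₁ (.leaf 1) := ⟨rfl⟩
instance : Denotes (atoms X₀ X₁ X₂ X₃ X₄ X₅ X₆ X₇) X₂ (.leaf 2) := ⟨rfl⟩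
instance : Denotes (atoms X₀ X₁ X₂ X₃ X₄ X₅ X₆ X₇) X₃ (.leaf 3) := ⟨rfl⟩
instance : Denotes (atoms X₀ X₁ X₂ X₃ X₄ X₅ X₆ X₇) X₄ (.leaf 4) := ⟨rfl⟩
instance : Denotes (atoms X₀ X₁ X₂ X₃ X₄ X₅ X₆ X₇) X₅ (.leaf 5) := ⟨rfl⟩
instance : Denotes (atoms X₀ X₁ X₂ X₃ X₄ X₅ X₆ X₇) X₆ (.leaf 6) := ⟨rfl⟩
instance : Denotes (atoms X₀ X₁ X₂ X₃ X₄ X₅ X₆ X₇) X₇ (.leaf 7) := ⟨rfl⟩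

end

instance midIso_structural {X Y Z W : C} {s t u v : Tree} [Denotes E X s] [Denotes E Y t]
    [Denotes E Z u] [Denotes E W v] : Structural E (midIso X Y Z W).hom
      (.tens (.tens s t) (.tens u v)) (.tens (.tens s u) (.tens t v)) := by
  unfold midIso tensorμ
  infer_instance

instance midIso_inv_structural {X Y Z W : C} {s t u v : Tree} [Denotes E X s] [Denotes E Y t]
    [Denotes E Z u] [Denotes E W v] : Structural E (midIso X Y Z W).inv
      (.tens (.tens s u) (.tens t v)) (.tens (.tens s t) (.tens u v)) := by
  unfold midIso tensorδ
  infer_instance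

instance leftComm_structural {X Y Z : C} {s t u : Tree} [Denotes E X s] [Denotes E Y t]
    [Denotes E Z u] : Structural E (leftComm X Y Z).hom
      (.tens s (.tens t u)) (.tens t (.tens s u)) := by
  simp only [leftComm, Iso.trans_hom, Iso.symm_hom, MonoidalCategory.tensorIso_hom, Iso.refl_hom]
  infer_instance

end SymmCoherence

/-! ### Naturality of quasi-injections and the action of the zero scalar -/

section Quasi

variable {C : Type u} [Category.{v} C] [MonoidalCategory C] [Limits.HasZeroMorphisms C]

theorem quasiInl_naturality {X X' Y Y' : C} (f : X ⟶ X') (g : Y ⟶ Y') :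
    quasiInl X Y ≫ (f ⊗ₘ g) = f ≫ quasiInl X' Y' := by
  simp only [quasiInl, Category.assoc]
  rw [MonoidalCategory.tensorHom_def', ← whiskerLeft_comp_assoc, Limits.zero_comp,
    whisker_exchange, ← rightUnitor_inv_naturality_assoc]

theorem quasiInr_naturality {X X' Y Y' : C} (f : X ⟶ X') (g : Y ⟶ Y') :
    quasiInr X Y ≫ (f ⊗ₘ g) = g ≫ quasiInr X' Y' := by
  simp only [quasiInr, Category.assoc]
  rw [MonoidalCategory.tensorHom_def, ← comp_whiskerRight_assoc, Limits.zero_comp,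
    ← whisker_exchange, ← leftUnitor_inv_naturality_assoc]

theorem quasiInl_whiskerRight {X X' : C} (Y : C) (f : X ⟶ X') :
    quasiInl X Y ≫ f ▷ Y = f ≫ quasiInl X' Y := by
  simpa using quasiInl_naturality f (𝟙 Y)

theorem quasiInl_whiskerLeft (X : C) {Y Y' : C} (f : Y ⟶ Y') :
    quasiInl X Y ≫ X ◁ f = quasiInl X Y' := by
  simpa using quasiInl_naturality (𝟙 X) f

theorem quasiInr_whiskerRight {X X' : C} (Y : C) (f : X ⟶ X') :
    quasiInr X Y ≫ f ▷ Y = quasiInr X' Y := by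
  simpa using quasiInr_naturality f (𝟙 Y)

theorem quasiInr_whiskerLeft (X : C) {Y Y' : C} (f : Y ⟶ Y') :
    quasiInr X Y ≫ X ◁ f = f ≫ quasiInr X Y' := by
  simpa using quasiInr_naturality (𝟙 X) f

/-- The zero endomorphism of the unit acts trivially on `X`. -/
def ZeroTrivial (X : C) : Prop := X ◁ (0 : 𝟙_ C ⟶ 𝟙_ C) = 𝟙 (X ⊗ 𝟙_ C)

theorem quasiInl_quasiFst (X Y : C) :
    quasiInl X Y ≫ quasiFst X Y = (ρ_ X).inv ≫ X ◁ (0 : 𝟙_ C ⟶ 𝟙_ C) ≫ (ρ_ X).hom := by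
  simp only [quasiInl, quasiFst, Category.assoc, ← whiskerLeft_comp_assoc, Limits.zero_comp]

theorem ZeroTrivial.quasiInl_quasiFst {X : C} (h : ZeroTrivial X) (Y : C) :
    quasiInl X Y ≫ quasiFst X Y = 𝟙 X := by
  rw [_root_.quasiInl_quasiFst, h]
  simp

theorem ZeroTrivial.of_retract {V W : C} (h : ZeroTrivial W) (i : V ⟶ W) (p : W ⟶ V)
    (hip : i ≫ p = 𝟙 V) : ZeroTrivial V := by
  unfold ZeroTrivial at h ⊢
  rw [← Category.id_comp (V ◁ _), ← id_whiskerRight, ← hip, comp_whiskerRight, Category.assoc,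
    ← whisker_exchange, h, Category.id_comp]

/-- A zero endomorphism of `Y` absorbs the zero scalar, hence so does any identity that factors
through it. -/
theorem ZeroTrivial.of_factor {X T Y : C} (i : X ⟶ T ⊗ Y) (p : T ⊗ Y ⟶ X)
    (h : i ≫ T ◁ (0 : Y ⟶ Y) ≫ p = 𝟙 X) : ZeroTrivial X := by
  unfold ZeroTrivial
  have h₁ : (T ◁ (0 : Y ⟶ Y)) ▷ 𝟙_ C ≫ (T ⊗ Y) ◁ (0 : 𝟙_ C ⟶ 𝟙_ C) = (T ◁ (0 : Y ⟶ Y)) ▷ 𝟙_ C := by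
    have : (0 : Y ⟶ Y) ▷ 𝟙_ C = 0 := by
      rw [whiskerRight_id]
      simp
    rw [whisker_assoc, this, tensor_whiskerLeft]
    simp [← whiskerLeft_comp_assoc]
  rw [← Category.id_comp (X ◁ _), ← id_whiskerRight, ← h, comp_whiskerRight, comp_whiskerRight,
    Category.assoc, Category.assoc, ← whisker_exchange, reassoc_of% h₁]

end Quasi

/-! ### Traces of rearranged morphisms -/

section Trace

open SymmCoherence TracedCategory

variable {C : Type u} [Category.{v} C] [MonoidalCategory C] [SymmetricCategory C]

/-- exchange of the last two factors -/
def rightSwap (Y W d : C) : (Y ⊗ W) ⊗ d ≅ (Y ⊗ d) ⊗ W :=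
  α_ Y W d ≪≫ (Iso.refl Y ⊗ᵢ β_ W d) ≪≫ (α_ Y d W).symm

theorem rightSwap_inv_naturality {Y Y' W W' d d' : C} (f : Y ⟶ Y') (g : W ⟶ W') (h : d ⟶ d') :
    ((f ⊗ₘ h) ⊗ₘ g) ≫ (rightSwap Y' W' d').inv = (rightSwap Y W d).inv ≫ ((f ⊗ₘ g) ⊗ₘ h) := by
  simp only [rightSwap, Iso.trans_inv, Iso.symm_inv, MonoidalCategory.tensorIso_inv, Iso.refl_inv,
    Category.assoc, associator_naturality_assoc, ← associator_inv_naturality]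
  rw [tensorHom_comp_tensorHom_assoc, tensorHom_comp_tensorHom_assoc,
    BraidedCategory.braiding_inv_naturality]
  simp

theorem midIso_naturality {W X Y Z W' X' Y' Z' : C} (f : W ⟶ W') (g : X ⟶ X') (h : Y ⟶ Y')
    (k : Z ⟶ Z') : ((f ⊗ₘ g) ⊗ₘ (h ⊗ₘ k)) ≫ (midIso W' X' Y' Z').hom =
      (midIso W X Y Z).hom ≫ ((f ⊗ₘ h) ⊗ₘ (g ⊗ₘ k)) :=
  tensorμ_natural f g h k

theorem midIso_inv_naturality {W X Y Z W' X' Y' Z' : C} (f : W ⟶ W') (g : X ⟶ X') (h : Y ⟶ Y')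
    (k : Z ⟶ Z') : ((f ⊗ₘ h) ⊗ₘ (g ⊗ₘ k)) ≫ (midIso W' X' Y' Z').inv =
      (midIso W X Y Z).inv ≫ ((f ⊗ₘ g) ⊗ₘ (h ⊗ₘ k)) := by
  rw [Iso.comp_inv_eq, Category.assoc, Iso.eq_inv_comp, midIso_naturality]

theorem ZeroTrivial.tensor [Limits.HasZeroMorphisms C] {X : C} (h : ZeroTrivial X) (Y : C) :
    ZeroTrivial (X ⊗ Y) := by
  have e := rightSwap_inv_naturality (𝟙 X) (𝟙 Y) (0 : 𝟙_ C ⟶ 𝟙_ C)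
  unfold ZeroTrivial at h ⊢
  rw [id_tensorHom, h, tensorHom_id, id_whiskerRight, Category.id_comp, id_tensorHom_id,
    id_tensorHom] at e
  rw [← cancel_epi (rightSwap X Y (𝟙_ C)).inv, ← e, Category.comp_id]

/-- the exchange of the conclusions of a cut, before the remaining cuts are traced out -/
def cutPerm (A n x P Pd : C) : (A ⊗ (n ⊗ x)) ⊗ (P ⊗ Pd) ≅ (P ⊗ n) ⊗ (A ⊗ (Pd ⊗ x)) :=
  (leftComm A n x ⊗ᵢ Iso.refl (P ⊗ Pd)) ≪≫ midIso n (A ⊗ x) P Pd ≪≫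
    (β_ n P ⊗ᵢ (α_ A x Pd ≪≫ (Iso.refl A ⊗ᵢ β_ x Pd)))

theorem cutPerm_inv_naturality (A n x : C) {P P' Q Q' : C} (f : P ⟶ P') (g : Q ⟶ Q') :
    (f ▷ n ⊗ₘ A ◁ g ▷ x) ≫ (cutPerm A n x P' Q').inv =
      (cutPerm A n x P Q).inv ≫ (A ⊗ (n ⊗ x)) ◁ (f ⊗ₘ g) := by
  rw [Iso.comp_inv_eq, Category.assoc, Iso.eq_inv_comp]
  simp only [cutPerm, Iso.trans_hom, MonoidalCategory.tensorIso_hom, Iso.refl_hom, Category.assoc]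
  have h := midIso_naturality (𝟙 n) (𝟙 (A ⊗ x)) f g
  rw [id_tensorHom_id, id_tensorHom] at h
  rw [tensorHom_id, tensorHom_id, whisker_exchange_assoc, reassoc_of% h,
    tensorHom_comp_tensorHom, tensorHom_comp_tensorHom]
  simp only [Category.assoc, ← whiskerLeft_comp,
    id_tensorHom, tensor_whiskerLeft, Iso.inv_hom_id_assoc,
    BraidedCategory.braiding_naturality_right]

section

variable [TracedCategory C]

/-- Naturality and dinaturality together: what acts on the traced factor before `x` is slid around
the loop. -/
theorem tr_conj {X X' Y Y' d d' : C} (f : X' ⟶ X) (c : d' ⟶ d) (x : X ⊗ d ⟶ Y ⊗ d) (g : Y ⟶ Y')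
    (c' : d ⟶ d') : tr d' ((f ⊗ₘ c) ≫ x ≫ (g ⊗ₘ c')) = f ≫ tr d (x ≫ Y ◁ (c' ≫ c)) ≫ g := by
  rw [MonoidalCategory.tensorHom_def f c, MonoidalCategory.tensorHom_def' g c', Category.assoc,
    tr_naturality_left, ← Category.assoc x, ← Category.assoc (X ◁ c), tr_naturality_right,
    ← tr_dinaturality]
  simp

theorem tr_transport {X Y d d' : C} (c : d ≅ d') {τ : d ⟶ d} {τ' : d' ⟶ d'}
    (h : τ ≫ c.hom = c.hom ≫ τ') (f : X ⊗ d' ⟶ Y ⊗ d') :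
    tr d (X ◁ c.hom ≫ f ≫ Y ◁ c.inv ≫ Y ◁ τ) = tr d' (f ≫ Y ◁ τ') := by
  have e := tr_conj (𝟙 X) c.hom f (𝟙 Y) (c.inv ≫ τ)
  rw [id_tensorHom, id_tensorHom, whiskerLeft_comp, Category.assoc, h, Iso.inv_hom_id_assoc] at e
  simpa using e

/-- Generalized yanking. -/
theorem tr_rightSwap_symmetry {X Y V : C} (f : X ⟶ Y ⊗ V) :
    tr V (f ▷ V ≫ (rightSwap Y V V).hom) = f := by
  have : (rightSwap Y V V).hom = (α_ Y V V).hom ≫ Y ◁ (β_ V V).hom ≫ (α_ Y V V).inv := by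
    simp [rightSwap]
  rw [this, tr_naturality_left, tr_superposing, tr_yanking]
  simp

end

variable [Limits.HasZeroMorphisms C]

instance {E : ℕ → C} {X Y Z : C} {s t u : Tree} [Denotes E X s] [Denotes E Y t]
    [Denotes E Z u] : Structural E (rightSwap X Y Z).hom
      (.tens (.tens s t) u) (.tens (.tens s u) t) := by
  simp only [rightSwap, Iso.trans_hom, Iso.symm_hom, MonoidalCategory.tensorIso_hom, Iso.refl_hom]
  infer_instance

instance {E : ℕ → C} {X Y Z : C} {s t u : Tree} [Denotes E X s] [Denotes E Y t]
    [Denotes E Z u] : Structural E (rightSwap X Y Z).inv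
      (.tens (.tens s u) t) (.tens (.tens s t) u) := by
  simp only [rightSwap, Iso.trans_inv, Iso.symm_inv, MonoidalCategory.tensorIso_inv, Iso.refl_inv]
  infer_instance

theorem quasiInl_midIso_inv (W X Y Z : C) : quasiInl (W ⊗ Y) (X ⊗ Z) ≫ (midIso W X Y Z).inv =
    quasiInl W X ⊗ₘ quasiInl Y Z :=
  -- The objects become leaves, with unused slots padded by an object already listed; `decide`
  -- checks that the leaves of the target are distinct.
  Structural.unique (atoms W X Y Z W W W W) (by decide)

theorem quasiInr_midIso_inv (W X Y Z : C) : quasiInr (W ⊗ Y) (X ⊗ Z) ≫ (midIso W X Y Z).inv =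
    quasiInr W X ⊗ₘ quasiInr Y Z :=
  Structural.unique (atoms W X Y Z W W W W) (by decide)

theorem quasiInr_midIso_hom (W X Y Z : C) : quasiInr (W ⊗ X) (Y ⊗ Z) ≫ (midIso W X Y Z).hom =
    quasiInr W Y ⊗ₘ quasiInr X Z :=
  Structural.unique (atoms W X Y Z W W W W) (by decide)

theorem quasiInl_midIso_hom (W X Y Z : C) : quasiInl (W ⊗ X) (Y ⊗ Z) ≫ (midIso W X Y Z).hom =
    quasiInl W Y ⊗ₘ quasiInl X Z :=
  Structural.unique (atoms W X Y Z W W W W) (by decide)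

variable [TracedCategory C]

/-- Superposing with the inert factor on the right, obtained from the left version by conjugation
with braidings. -/
theorem tr_rightSwap {Y Y' W W' d : C} (x : Y ⊗ d ⟶ Y' ⊗ d) (v : W ⟶ W') :
    tr d ((rightSwap Y W d).hom ≫ (x ⊗ₘ v) ≫ (rightSwap Y' W' d).inv) = tr d x ⊗ₘ v := by
  have h₁ : (rightSwap Y W d).hom = (β_ Y W).hom ▷ d ≫ (α_ W Y d).hom ≫ (β_ W (Y ⊗ d)).hom :=
    Structural.unique (atoms Y W d Y Y Y Y Y) (by decide)
  have h₂ : (rightSwap Y' W d).inv =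
      (β_ (Y' ⊗ d) W).hom ≫ (α_ W Y' d).inv ≫ (β_ W Y').hom ▷ d :=
    Structural.unique (atoms Y' W d Y' Y' Y' Y' Y') (by decide)
  have h₃ := rightSwap_inv_naturality (𝟙 Y') v (𝟙 d)
  simp only [id_tensorHom, tensorHom_id, id_whiskerRight] at h₃
  rw [MonoidalCategory.tensorHom_def, Category.assoc, h₃, ← Category.assoc, ← Category.assoc,
    tr_naturality_right, Category.assoc, h₁, h₂]
  have : ((β_ Y W).hom ▷ d ≫ (α_ W Y d).hom ≫ (β_ W (Y ⊗ d)).hom) ≫ x ▷ W ≫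
      (β_ (Y' ⊗ d) W).hom ≫ (α_ W Y' d).inv ≫ (β_ W Y').hom ▷ d =
      (β_ Y W).hom ▷ d ≫ ((α_ W Y d).hom ≫ W ◁ x ≫ (α_ W Y' d).inv) ≫ (β_ W Y').hom ▷ d := by
    simp only [Category.assoc]
    rw [← BraidedCategory.braiding_naturality_right_assoc, SymmetricCategory.symmetry_assoc]
  rw [this, tr_naturality_left, tr_naturality_right, tr_superposing,
    BraidedCategory.braiding_naturality_right, SymmetricCategory.symmetry_assoc,
    MonoidalCategory.tensorHom_def]

theorem tr_midIso {A A' B B' d d' : C} (x : A ⊗ d ⟶ A' ⊗ d) (y : B ⊗ d' ⟶ B' ⊗ d') :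
    tr (d ⊗ d') ((midIso A B d d').hom ≫ (x ⊗ₘ y) ≫ (midIso A' B' d d').inv) =
      tr d x ⊗ₘ tr d' y := by
  have h₁ : (α_ (A ⊗ B) d d').hom ≫ (midIso A B d d').hom =
      (rightSwap A B d).hom ▷ d' ≫ (α_ (A ⊗ d) B d').hom :=
    Structural.unique (atoms A B d d' A A A A) (by decide)
  have h₂ : (midIso A' B' d d').inv ≫ (α_ (A' ⊗ B') d d').inv =
      (α_ (A' ⊗ d) B' d').inv ≫ (rightSwap A' B' d).inv ▷ d' :=
    Structural.unique (atoms A' B' d d' A' A' A' A') (by decide)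
  have : (α_ (A ⊗ B) d d').hom ≫ ((midIso A B d d').hom ≫ (x ⊗ₘ y) ≫ (midIso A' B' d d').inv) ≫
      (α_ (A' ⊗ B') d d').inv = ((rightSwap A B d).hom ≫ x ▷ B) ▷ d' ≫
        ((α_ (A' ⊗ d) B d').hom ≫ (A' ⊗ d) ◁ y ≫ (α_ (A' ⊗ d) B' d').inv) ≫
          (rightSwap A' B' d).inv ▷ d' := by
    simp only [Category.assoc]
    rw [reassoc_of% h₁, h₂, MonoidalCategory.tensorHom_def]
    simp
  rw [tr_vanishing_tensor, this, tr_naturality_left, tr_naturality_right, tr_superposing,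
    Category.assoc, ← MonoidalCategory.tensorHom_def_assoc, tr_rightSwap]

theorem tr_shift {Z Z' Y Y' W W' d : C} (u : Z ⟶ Z') (x : Y ⊗ d ⟶ Y' ⊗ d) (v : W ⟶ W') :
    tr d (((α_ Z (Y ⊗ W) d).hom ≫ Z ◁ (rightSwap Y W d).hom) ≫ (u ⊗ₘ (x ⊗ₘ v)) ≫
      Z' ◁ (rightSwap Y' W' d).inv ≫ (α_ Z' (Y' ⊗ W') d).inv) = u ⊗ₘ (tr d x ⊗ₘ v) := by
  have : ((α_ Z (Y ⊗ W) d).hom ≫ Z ◁ (rightSwap Y W d).hom) ≫ (u ⊗ₘ (x ⊗ₘ v)) ≫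
      Z' ◁ (rightSwap Y' W' d).inv ≫ (α_ Z' (Y' ⊗ W') d).inv =
      ((α_ Z (Y ⊗ W) d).hom ≫ Z ◁ ((rightSwap Y W d).hom ≫ (x ⊗ₘ v) ≫
        (rightSwap Y' W' d).inv) ≫ (α_ Z (Y' ⊗ W') d).inv) ≫ u ▷ (Y' ⊗ W') ▷ d := by
    simp only [MonoidalCategory.tensorHom_def' u, Category.assoc, whiskerLeft_comp,
      ← whisker_exchange_assoc, associator_inv_naturality_left]
  rw [this, tr_naturality_right, tr_superposing, tr_rightSwap, MonoidalCategory.tensorHom_def' u]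

/-- The trace of `V` is determined by what happens to the zero input. -/
def ZeroUniform (V : C) : Prop :=
  ∀ {X Y : C} (f : X ⊗ V ⟶ Y ⊗ V) (g : X ⟶ Y), quasiInl X V ≫ f = g ≫ quasiInl Y V →
    tr V f = g ≫ quasiInl Y (𝟙_ C) ≫ quasiFst Y (𝟙_ C)

/-- By dinaturality a trace over a retract is a trace over the larger object, and `i`, `p` preserve
the zero input. -/
theorem ZeroUniform.of_retract {V W : C} (hW : ZeroUniform W) (i : V ⟶ W) (p : W ⟶ V)
    (h : i ≫ p = 𝟙 V) : ZeroUniform V := by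
  intro X Y f g hfg
  rw [← hW (X ◁ p ≫ f ≫ Y ◁ i) g, ← Category.assoc, tr_dinaturality, ← whiskerLeft_comp_assoc, h]
  · simp
  · rw [← Category.assoc, quasiInl_whiskerLeft, reassoc_of% hfg, quasiInl_whiskerLeft]

instance {E : ℕ → C} {A n x P Q : C} {sA sn sx sP sQ : Tree} [Denotes E A sA] [Denotes E n sn]
    [Denotes E x sx] [Denotes E P sP] [Denotes E Q sQ] : Structural E (cutPerm A n x P Q).hom
      (.tens (.tens sA (.tens sn sx)) (.tens sP sQ))
      (.tens (.tens sP sn) (.tens sA (.tens sQ sx))) := by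
  simp only [cutPerm, Iso.trans_hom, MonoidalCategory.tensorIso_hom, Iso.refl_hom]
  infer_instance

instance leftComm_inv_structural {E : ℕ → C} {X Y Z : C} {s t u : Tree} [Denotes E X s]
    [Denotes E Y t] [Denotes E Z u] : Structural E (leftComm X Y Z).inv
      (.tens t (.tens s u)) (.tens s (.tens t u)) := by
  simp only [leftComm, Iso.trans_inv, Iso.symm_inv, MonoidalCategory.tensorIso_inv, Iso.refl_inv]
  infer_instance

instance {E : ℕ → C} {A n x P Q : C} {sA sn sx sP sQ : Tree} [Denotes E A sA] [Denotes E n sn]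
    [Denotes E x sx] [Denotes E P sP] [Denotes E Q sQ] : Structural E (cutPerm A n x P Q).inv
      (.tens (.tens sP sn) (.tens sA (.tens sQ sx)))
      (.tens (.tens sA (.tens sn sx)) (.tens sP sQ)) := by
  simp only [cutPerm, Iso.trans_inv, MonoidalCategory.tensorIso_inv, Iso.refl_inv]
  infer_instance

/-- The loop through the two premises of a cut, opened at the negative cut formula. -/
theorem tr_cut_eq {A n x P Q : C} (F : P ⊗ n ⟶ P ⊗ n) (G : A ⊗ (Q ⊗ x) ⟶ A ⊗ (Q ⊗ x))
    (a : Q ⟶ P) (b : P ⟶ Q) :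
    tr (P ⊗ Q) ((cutPerm A n x P Q).hom ≫ (F ⊗ₘ G) ≫ (cutPerm A n x P Q).inv ≫
      (A ⊗ (n ⊗ x)) ◁ ((β_ P Q).hom ≫ (a ⊗ₘ b))) =
    tr Q ((((α_ A (n ⊗ x) Q).hom ≫ A ◁ ((α_ n x Q).hom ≫ (β_ n (x ⊗ Q)).hom ≫ (β_ x Q).hom ▷ n) ≫
        (α_ A (Q ⊗ x) n).inv) ≫ (G ≫ A ◁ a ▷ x) ▷ n ≫
        (A ◁ (β_ P x).hom ≫ (α_ A x P).inv) ▷ n ≫ (rightSwap (A ⊗ x) P n).hom) ≫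
      ((α_ (A ⊗ x) n P).hom ≫ (A ⊗ x) ◁ (β_ n P).hom) ≫ (A ⊗ x) ◁ (F ≫ b ▷ n) ≫
        (A ⊗ x) ◁ (β_ Q n).hom ≫ (α_ (A ⊗ x) n Q).inv ≫
          ((α_ A x n).hom ≫ A ◁ (β_ x n).hom) ▷ Q) := by
  set c₁ := (α_ A (n ⊗ x) Q).hom ≫ A ◁ ((α_ n x Q).hom ≫ (β_ n (x ⊗ Q)).hom ≫ (β_ x Q).hom ▷ n) ≫
    (α_ A (Q ⊗ x) n).inv with hc₁
  set c₂ := (A ◁ (β_ P x).hom ≫ (α_ A x P).inv) ▷ n ≫ (rightSwap (A ⊗ x) P n).hom with hc₂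
  set c₃ := (α_ (A ⊗ x) n P).hom ≫ (A ⊗ x) ◁ (β_ n P).hom with hc₃
  set c₄ := (A ⊗ x) ◁ (β_ Q n).hom ≫ (α_ (A ⊗ x) n Q).inv ≫
    ((α_ A x n).hom ≫ A ◁ (β_ x n).hom) ▷ Q with hc₄
  -- The permutations are parametrized by an object so that naturality in it moves `G`, `a` past
  -- `s₃` and `F`, `b` past `s₄`.
  set s₃ : ∀ W : C, (W ⊗ n) ⊗ P ⟶ (P ⊗ n) ⊗ W :=
    fun W => (α_ W n P).hom ≫ W ◁ (β_ n P).hom ≫ (β_ W (P ⊗ n)).hom with hs₃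
  set s₄ : ∀ R P : C, R ⊗ (A ⊗ (P ⊗ x)) ⟶ ((A ⊗ x) ⊗ R) ⊗ P :=
    fun R P => R ◁ (A ◁ (β_ P x).hom ≫ (α_ A x P).inv) ≫ (α_ R (A ⊗ x) P).inv ≫
      (β_ R (A ⊗ x)).hom ▷ P with hs₄
  have n₃ {W W' : C} (g : W ⟶ W') : g ▷ n ▷ P ≫ s₃ W' = s₃ W ≫ (P ⊗ n) ◁ g := by
    simp only [hs₃, Category.assoc]
    rw [← BraidedCategory.braiding_naturality_left, whisker_exchange_assoc,
      associator_naturality_left_assoc]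
  have n₄ {R R' : C} (g : R ⟶ R') : s₄ R P ≫ ((A ⊗ x) ◁ g) ▷ P = g ▷ (A ⊗ (P ⊗ x)) ≫ s₄ R' P := by
    simp only [hs₄, Category.assoc]
    rw [← comp_whiskerRight, ← BraidedCategory.braiding_naturality_left, comp_whiskerRight,
      ← associator_inv_naturality_left_assoc, whisker_exchange_assoc]
  have k₁ : (α_ (A ⊗ (n ⊗ x)) Q P).hom ≫ (A ⊗ (n ⊗ x)) ◁ (β_ Q P).hom ≫ (cutPerm A n x P Q).hom =
      c₁ ▷ P ≫ s₃ (A ⊗ (Q ⊗ x)) :=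
    Structural.unique (atoms A n x P Q A A A) (by decide)
  have k₂ (P' : C) : s₃ (A ⊗ (P' ⊗ x)) ≫ s₄ (P ⊗ n) P' =
      ((A ◁ (β_ P' x).hom ≫ (α_ A x P').inv) ▷ n ≫ (rightSwap (A ⊗ x) P' n).hom) ▷ P ≫
        (rightSwap ((A ⊗ x) ⊗ n) P' P).hom ≫ c₃ ▷ P' :=
    Structural.unique (atoms A n x P P' A A A) (by decide)
  have k₃ : s₄ (Q ⊗ n) P ≫ c₄ ▷ P =
      (cutPerm A n x Q P).inv ≫ (α_ (A ⊗ (n ⊗ x)) Q P).inv :=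
    Structural.unique (atoms A n x P Q A A A) (by decide)
  have hb : (β_ P Q).hom ≫ (a ⊗ₘ b) = (b ⊗ₘ a) ≫ (β_ Q P).hom := by
    rw [BraidedCategory.braiding_naturality]
  -- The symmetry is slid to the front, turning the traced object into `Q ⊗ P`; the inner trace over
  -- `P` is then a bare wire, removed by generalized yanking.
  rw [hb, whiskerLeft_comp]
  simp only [← Category.assoc _ _ ((A ⊗ (n ⊗ x)) ◁ (β_ Q P).hom)]
  rw [tr_dinaturality, tr_vanishing_tensor]
  congr 1
  have : (α_ (A ⊗ (n ⊗ x)) Q P).hom ≫ ((A ⊗ (n ⊗ x)) ◁ (β_ Q P).hom ≫ (cutPerm A n x P Q).hom ≫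
      (F ⊗ₘ G) ≫ (cutPerm A n x P Q).inv ≫ (A ⊗ (n ⊗ x)) ◁ (b ⊗ₘ a)) ≫
      (α_ (A ⊗ (n ⊗ x)) Q P).inv =
      (c₁ ≫ (G ≫ A ◁ a ▷ x) ▷ n ≫ c₂) ▷ P ≫ (rightSwap ((A ⊗ x) ⊗ n) P P).hom ≫
        (c₃ ≫ (A ⊗ x) ◁ (F ≫ b ▷ n) ≫ c₄) ▷ P := by
    simp only [Category.assoc]
    have e₁ := cutPerm_inv_naturality A n x b a
    have e₂ : (b ▷ n ⊗ₘ A ◁ a ▷ x) = (P ⊗ n) ◁ (A ◁ a ▷ x) ≫ b ▷ n ▷ (A ⊗ (P ⊗ x)) :=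
      MonoidalCategory.tensorHom_def' _ _
    rw [← reassoc_of% e₁, ← k₃, reassoc_of% k₁, MonoidalCategory.tensorHom_def' F G, e₂]
    simp only [Category.assoc, comp_whiskerRight, whiskerLeft_comp]
    rw [← whisker_exchange_assoc F (A ◁ a ▷ x), ← reassoc_of% (n₃ G),
      ← reassoc_of% (n₃ (A ◁ a ▷ x)), hc₂,
      ← reassoc_of% (k₂ P), reassoc_of% (n₄ F), reassoc_of% (n₄ (b ▷ n))]
  rw [this]
  generalize c₁ ≫ (G ≫ A ◁ a ▷ x) ▷ n ≫ c₂ = K₁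
  generalize c₃ ≫ (A ⊗ x) ◁ (F ≫ b ▷ n) ≫ c₄ = K₂
  rw [← Category.assoc, tr_naturality_right, tr_rightSwap_symmetry]

/-- The computation behind cut. With zero on the opened wire `Q`, the point `z` passes through `G`,
its `Q`-component through `a` into `F`, and `F` answers on `n` with zero on `P`. The return map `b`
then carries only that zero, so it can be arbitrary. -/
theorem tr_cut {A n x P Q Z : C} (hQ : ZeroUniform Q) (hA : ZeroTrivial A) {F : P ⊗ n ⟶ P ⊗ n}
    {G : A ⊗ (Q ⊗ x) ⟶ A ⊗ (Q ⊗ x)} {a : Q ⟶ P} (b : P ⟶ Q) {z : Z ⟶ A} {w : Z ⟶ Q ⊗ x}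
    {w' : Z ⟶ n ⊗ x} (hG : z ≫ quasiInl A (Q ⊗ x) ≫ G = w ≫ quasiInr A (Q ⊗ x))
    (hF : w ≫ (a ≫ quasiInl P n ≫ F) ▷ x = w' ≫ quasiInr P n ▷ x) :
    z ≫ quasiInl A (n ⊗ x) ≫ tr (P ⊗ Q) ((cutPerm A n x P Q).hom ≫ (F ⊗ₘ G) ≫
      (cutPerm A n x P Q).inv ≫ (A ⊗ (n ⊗ x)) ◁ ((β_ P Q).hom ≫ (a ⊗ₘ b))) =
    w' ≫ quasiInr A (n ⊗ x) := by
  rw [tr_cut_eq, ← Category.assoc, ← tr_naturality_left]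
  rw [hQ _ (w' ≫ quasiInr A (n ⊗ x))]
  -- `ZeroUniform` leaves a zero scalar on the output, which acts trivially because of the factor
  -- `A`.
  · rw [(hA.tensor _).quasiInl_quasiFst, Category.comp_id]
  have h₁ : quasiInl A (n ⊗ x) ≫ quasiInl (A ⊗ (n ⊗ x)) Q ≫ (α_ A (n ⊗ x) Q).hom ≫
      A ◁ ((α_ n x Q).hom ≫ (β_ n (x ⊗ Q)).hom ≫ (β_ x Q).hom ▷ n) ≫ (α_ A (Q ⊗ x) n).inv =
      quasiInl A (Q ⊗ x) ≫ quasiInl (A ⊗ (Q ⊗ x)) n :=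
    Structural.unique (atoms A n x Q A A A A) (by decide)
  have h₂ : quasiInr A (P ⊗ x) ≫ quasiInl (A ⊗ (P ⊗ x)) n ≫
      (A ◁ (β_ P x).hom ≫ (α_ A x P).inv) ▷ n ≫ (rightSwap (A ⊗ x) P n).hom ≫
      (α_ (A ⊗ x) n P).hom ≫ (A ⊗ x) ◁ (β_ n P).hom =
      quasiInl P n ▷ x ≫ (β_ (P ⊗ n) x).hom ≫ quasiInr A x ▷ (P ⊗ n) :=
    Structural.unique (atoms A n x P A A A A) (by decide)
  have h₃ : quasiInr Q n ▷ x ≫ (β_ (Q ⊗ n) x).hom ≫ quasiInr A x ▷ (Q ⊗ n) ≫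
      (A ⊗ x) ◁ (β_ Q n).hom ≫ (α_ (A ⊗ x) n Q).inv ≫ ((α_ A x n).hom ≫ A ◁ (β_ x n).hom) ▷ Q =
      quasiInr A (n ⊗ x) ≫ quasiInl (A ⊗ (n ⊗ x)) Q :=
    Structural.unique (atoms A n x Q A A A A) (by decide)
  rw [← Category.assoc (quasiInl Z Q), quasiInl_whiskerRight]
  simp only [Category.assoc]
  rw [reassoc_of% h₁, ← Category.assoc (quasiInl (A ⊗ (Q ⊗ x)) n), quasiInl_whiskerRight]
  simp only [Category.assoc]
  rw [reassoc_of% hG, ← Category.assoc (quasiInr A (Q ⊗ x)), quasiInr_whiskerLeft]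
  simp only [Category.assoc]
  rw [reassoc_of% h₂, ← whisker_exchange_assoc,
    ← BraidedCategory.braiding_naturality_left_assoc]
  simp only [comp_whiskerRight, Category.assoc] at hF ⊢
  simp only [comp_whiskerRight] at h₃
  -- The zero on `P` absorbs `b`, so zero comes back on `Q`.
  rw [reassoc_of% hF, ← comp_whiskerRight_assoc (quasiInr P n), quasiInr_whiskerRight, h₃]

/-- The cuts inside the two premises are executed first, leaving one loop over the new cut pair, to
which `tr_cut` applies. -/
theorem tr_cutTau {A n x P Q D D' : C} (x₁ : (P ⊗ n) ⊗ D ⟶ (P ⊗ n) ⊗ D)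
    (x₂ : (A ⊗ (Q ⊗ x)) ⊗ D' ⟶ (A ⊗ (Q ⊗ x)) ⊗ D') (σ : P ⊗ Q ⟶ P ⊗ Q) (τ₁ : D ⟶ D)
    (τ₂ : D' ⟶ D') :
    tr ((P ⊗ Q) ⊗ (D ⊗ D')) ((cutTau A n x P Q D D').hom ≫ (x₁ ⊗ₘ x₂) ≫
      (cutTau A n x P Q D D').inv ≫ (A ⊗ (n ⊗ x)) ◁ (σ ⊗ₘ (τ₁ ⊗ₘ τ₂))) =
    tr (P ⊗ Q) ((cutPerm A n x P Q).hom ≫ (tr D (x₁ ≫ (P ⊗ n) ◁ τ₁) ⊗ₘ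
      tr D' (x₂ ≫ (A ⊗ (Q ⊗ x)) ◁ τ₂)) ≫ (cutPerm A n x P Q).inv ≫ (A ⊗ (n ⊗ x)) ◁ σ) := by
  have k₁ : (α_ (A ⊗ (n ⊗ x)) (P ⊗ Q) (D ⊗ D')).hom ≫ (cutTau A n x P Q D D').hom =
      (cutPerm A n x P Q).hom ▷ (D ⊗ D') ≫ (midIso (P ⊗ n) (A ⊗ (Q ⊗ x)) D D').hom := by
    simp only [cutTau, Iso.trans_hom, Iso.symm_hom, MonoidalCategory.tensorIso_hom, Iso.refl_hom]
    exact Structural.unique (atoms A n x P Q D D' A) (by decide)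
  have k₂ : (cutTau A n x P Q D D').inv ≫
      (A ⊗ (n ⊗ x)) ◁ (σ ⊗ₘ (τ₁ ⊗ₘ τ₂)) ≫ (α_ (A ⊗ (n ⊗ x)) (P ⊗ Q) (D ⊗ D')).inv =
      (((P ⊗ n) ◁ τ₁) ⊗ₘ ((A ⊗ (Q ⊗ x)) ◁ τ₂)) ≫
        (midIso (P ⊗ n) (A ⊗ (Q ⊗ x)) D D').inv ≫
          ((cutPerm A n x P Q).inv ≫ (A ⊗ (n ⊗ x)) ◁ σ) ▷ (D ⊗ D') := by
    have e₁ := midIso_inv_naturality (𝟙 (P ⊗ n)) (𝟙 (A ⊗ (Q ⊗ x))) τ₁ τ₂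
    rw [id_tensorHom_id, id_tensorHom, id_tensorHom, id_tensorHom] at e₁
    rw [reassoc_of% e₁, Iso.inv_comp_eq, ← cancel_epi (α_ _ _ _).hom, reassoc_of% k₁,
      Iso.hom_inv_id_assoc, comp_whiskerRight, whisker_exchange_assoc, ← comp_whiskerRight_assoc,
      Iso.hom_inv_id, id_whiskerRight, Category.id_comp]
    generalize A ⊗ (n ⊗ x) = T
    rw [MonoidalCategory.tensorHom_def', whiskerLeft_comp, Category.assoc,
      associator_inv_naturality_middle, associator_inv_naturality_right_assoc,
      Iso.hom_inv_id_assoc]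
  have e₂ : (α_ (A ⊗ (n ⊗ x)) (P ⊗ Q) (D ⊗ D')).hom ≫
      ((cutTau A n x P Q D D').hom ≫ (x₁ ⊗ₘ x₂) ≫ (cutTau A n x P Q D D').inv ≫
        (A ⊗ (n ⊗ x)) ◁ (σ ⊗ₘ (τ₁ ⊗ₘ τ₂))) ≫ (α_ (A ⊗ (n ⊗ x)) (P ⊗ Q) (D ⊗ D')).inv =
      (cutPerm A n x P Q).hom ▷ (D ⊗ D') ≫ ((midIso (P ⊗ n) (A ⊗ (Q ⊗ x)) D D').hom ≫
          ((x₁ ≫ (P ⊗ n) ◁ τ₁) ⊗ₘ (x₂ ≫ (A ⊗ (Q ⊗ x)) ◁ τ₂)) ≫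
          (midIso (P ⊗ n) (A ⊗ (Q ⊗ x)) D D').inv) ≫
        ((cutPerm A n x P Q).inv ≫ (A ⊗ (n ⊗ x)) ◁ σ) ▷ (D ⊗ D') := by
    simp only [Category.assoc, ← tensorHom_comp_tensorHom]
    rw [reassoc_of% k₁, k₂]
  rw [tr_vanishing_tensor, e₂, tr_naturality_left, tr_naturality_right, tr_midIso]

theorem tr_tensorTau {A B n x D D' : C} (x₁ : (A ⊗ n) ⊗ D ⟶ (A ⊗ n) ⊗ D)
    (x₂ : (B ⊗ x) ⊗ D' ⟶ (B ⊗ x) ⊗ D') (τ₁ : D ⟶ D) (τ₂ : D' ⟶ D') :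
    tr (D ⊗ D') ((tensorTau A B n x D D').hom ≫ (x₁ ⊗ₘ x₂) ≫
      (tensorTau A B n x D D').inv ≫ ((A ⊗ B) ⊗ (n ⊗ x)) ◁ (τ₁ ⊗ₘ τ₂)) =
    (midIso A B n x).hom ≫ (tr D (x₁ ≫ (A ⊗ n) ◁ τ₁) ⊗ₘ tr D' (x₂ ≫ (B ⊗ x) ◁ τ₂)) ≫
      (midIso A B n x).inv := by
  have e₁ := midIso_inv_naturality (𝟙 (A ⊗ n)) (𝟙 (B ⊗ x)) τ₁ τ₂
  rw [id_tensorHom_id, id_tensorHom, id_tensorHom, id_tensorHom] at e₁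
  have e₂ : (tensorTau A B n x D D').hom ≫ (x₁ ⊗ₘ x₂) ≫ (tensorTau A B n x D D').inv ≫
      ((A ⊗ B) ⊗ (n ⊗ x)) ◁ (τ₁ ⊗ₘ τ₂) = (midIso A B n x).hom ▷ _ ≫
        ((midIso (A ⊗ n) (B ⊗ x) _ _).hom ≫ ((x₁ ≫ _ ◁ τ₁) ⊗ₘ (x₂ ≫ _ ◁ τ₂)) ≫
          (midIso (A ⊗ n) (B ⊗ x) _ _).inv) ≫ (midIso A B n x).inv ▷ _ := by
    simp only [tensorTau, Iso.trans_hom, Iso.trans_inv, MonoidalCategory.tensorIso_hom,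
      MonoidalCategory.tensorIso_inv, Iso.refl_hom, Iso.refl_inv, tensorHom_id, Category.assoc,
      ← tensorHom_comp_tensorHom]
    rw [← whisker_exchange, reassoc_of% e₁]
  rw [e₂, tr_naturality_left, tr_naturality_right, tr_midIso]

/-- The premise of a promotion is traced out after its context has been duplicated. -/
theorem tr_downTau {T N n W T' W' d : C} (u : T ⟶ W') (v : W ⟶ T')
    (x : (𝟙_ C ⊗ (N ⊗ n)) ⊗ d ⟶ (𝟙_ C ⊗ (N ⊗ n)) ⊗ d) (τ : d ⟶ d) :
    tr d ((downTau T N n W d).hom ≫ (u ⊗ₘ (x ⊗ₘ v)) ≫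
      (outerSwap W' ((𝟙_ C ⊗ (N ⊗ n)) ⊗ d) T').hom ≫ (downTau T' N n W' d).inv ≫
      ((T' ⊗ N) ⊗ (n ⊗ W')) ◁ τ) =
    ((α_ T N (n ⊗ W)).hom ≫ T ◁ ((α_ N n W).inv ≫ (λ_ (N ⊗ n)).inv ▷ W)) ≫
      (u ⊗ₘ (tr d (x ≫ _ ◁ τ) ⊗ₘ v)) ≫ (outerSwap W' (𝟙_ C ⊗ (N ⊗ n)) T').hom ≫
        T' ◁ ((λ_ (N ⊗ n)).hom ▷ W' ≫ (α_ N n W').hom) ≫ (α_ T' N (n ⊗ W')).inv := by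
  have k₁ : (downTau T N n W d).hom =
      ((α_ T N (n ⊗ W)).hom ≫ T ◁ ((α_ N n W).inv ≫ (λ_ (N ⊗ n)).inv ▷ W)) ▷ d ≫
      (α_ T ((𝟙_ C ⊗ (N ⊗ n)) ⊗ W) d).hom ≫ T ◁ (rightSwap (𝟙_ C ⊗ (N ⊗ n)) W d).hom := by
    simp only [downTau, Iso.trans_hom, Iso.symm_hom, MonoidalCategory.tensorIso_hom, Iso.refl_hom]
    exact Structural.unique (atoms T N n W d T T T) (by decide)
  have k₂ : (outerSwap W' ((𝟙_ C ⊗ (N ⊗ n)) ⊗ d) T').hom ≫ (downTau T' N n W' d).inv =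
      (W' ◁ (rightSwap (𝟙_ C ⊗ (N ⊗ n)) T' d).inv ≫ (α_ W' ((𝟙_ C ⊗ (N ⊗ n)) ⊗ T') d).inv) ≫
      ((outerSwap W' (𝟙_ C ⊗ (N ⊗ n)) T').hom ≫
        T' ◁ ((λ_ (N ⊗ n)).hom ▷ W' ≫ (α_ N n W').hom) ≫ (α_ T' N (n ⊗ W')).inv) ▷ d := by
    simp only [downTau, outerSwap, Iso.trans_hom, MonoidalCategory.tensorIso_hom,
      Iso.refl_hom, Iso.trans_inv, Iso.symm_inv, MonoidalCategory.tensorIso_inv, Iso.refl_inv]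
    exact Structural.unique (atoms T' N n W' d T' T' T') (by decide)
  have k₃ : (W' ◁ (rightSwap (𝟙_ C ⊗ (N ⊗ n)) T' d).inv ≫
      (α_ W' ((𝟙_ C ⊗ (N ⊗ n)) ⊗ T') d).inv) ≫ (W' ⊗ ((𝟙_ C ⊗ (N ⊗ n)) ⊗ T')) ◁ τ =
      W' ◁ ((_ ◁ τ) ▷ T') ≫ W' ◁ (rightSwap (𝟙_ C ⊗ (N ⊗ n)) T' d).inv ≫
        (α_ W' ((𝟙_ C ⊗ (N ⊗ n)) ⊗ T') d).inv := by
    have e := rightSwap_inv_naturality (𝟙 (𝟙_ C ⊗ (N ⊗ n))) (𝟙 T') τ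
    rw [id_tensorHom_id, id_tensorHom, id_tensorHom, tensorHom_id] at e
    rw [Category.assoc, ← associator_inv_naturality_right, ← whiskerLeft_comp_assoc,
      ← whiskerLeft_comp_assoc, e]
  have k₄ : (u ⊗ₘ (x ⊗ₘ v)) ≫ W' ◁ ((_ ◁ τ) ▷ T') = u ⊗ₘ ((x ≫ _ ◁ τ) ⊗ₘ v) := by
    rw [← id_tensorHom, ← tensorHom_id, tensorHom_comp_tensorHom, tensorHom_comp_tensorHom,
      Category.comp_id, Category.comp_id]
  rw [k₁, reassoc_of% k₂, ← whisker_exchange, Category.assoc, reassoc_of% k₃, reassoc_of% k₄,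
    tr_naturality_left, ← tr_shift]
  simp only [← Category.assoc]
  rw [tr_naturality_right]
  simp only [Category.assoc]

end Trace

/-! ### Naturality of maps between sequences -/

section

variable {C : Type u} [Category.{v} C] [MonoidalCategory C] {At : Type w} {F G : Asg At C}

theorem cutMap_id (F : Asg At C) : ∀ Δ : List (Form At .pos), cutMap (fun p A => 𝟙 (F p A)) Δ = 𝟙 _
  | [] => rfl
  | P :: Δ => by simp [cutMap, cutMap_id F Δ]

theorem negMap_id (F : Asg At C) : ∀ 𝒩 : List (Form At .neg),
    negMap (fun p A => 𝟙 (F p A)) 𝒩 = 𝟙 _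
  | [] => rfl
  | N :: 𝒩 => by simp [negMap, negMap_id F 𝒩]

theorem negMap_comp_negMap {H : Asg At C} (φ : ∀ p A, F p A ⟶ G p A) (ψ : ∀ p A, G p A ⟶ H p A) :
    ∀ 𝒩 : List (Form At .neg), negMap φ 𝒩 ≫ negMap ψ 𝒩 = negMap (fun p A => φ p A ≫ ψ p A) 𝒩
  | [] => Category.comp_id _
  | N :: 𝒩 => by simp [negMap, negMap_comp_negMap φ ψ 𝒩]

theorem negMap_append (φ : ∀ p A, F p A ⟶ G p A) : ∀ 𝒩 ℳ : List (Form At .neg),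
    negMap φ (𝒩 ++ ℳ) ≫ (negAppend G 𝒩 ℳ).hom =
      (negAppend F 𝒩 ℳ).hom ≫ (negMap φ 𝒩 ⊗ₘ negMap φ ℳ)
  | [], ℳ => by simp [negMap, negAppend]
  | N :: 𝒩, ℳ => by
    have := negMap_append φ 𝒩 ℳ
    simp only [List.cons_append, negMap, negAppend, Iso.trans_hom,
      MonoidalCategory.tensorIso_hom, Iso.refl_hom, Iso.symm_hom, Category.assoc]
    rw [← associator_inv_naturality, tensorHom_comp_tensorHom_assoc,
      tensorHom_comp_tensorHom_assoc, this, Category.comp_id, Category.id_comp]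

theorem negMap_exchIso [SymmetricCategory C] (φ : ∀ p A, F p A ⟶ G p A) :
    ∀ {𝒩 𝒩' : List (Form At .neg)} (e : Exch 𝒩 𝒩'),
      negMap φ 𝒩 ≫ (exchIso G e).hom = (exchIso F e).hom ≫ negMap φ 𝒩'
  | _, _, .refl _ => by simp [exchIso]
  | _, _, .swap N M 𝒩 => SymmCoherence.leftComm_naturality _ _ _
  | _, _, .cons N e => by
    simp only [exchIso, negMap, MonoidalCategory.tensorIso_hom, Iso.refl_hom,
      tensorHom_comp_tensorHom, negMap_exchIso φ e, Category.comp_id, Category.id_comp]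
  | _, _, .trans e e' => by
    simp only [exchIso, Iso.trans_hom, Category.assoc]
    rw [← negMap_exchIso φ e', ← Category.assoc, negMap_exchIso φ e, Category.assoc]

end

/-! ### Zero-uniformity in a polarized GoI situation -/

namespace PolarizedGoI

open SymmCoherence TracedCategory

variable {C : Type u} [Category.{v} C] [MonoidalCategory C] [SymmetricCategory C]
  [TracedCategory C] [Limits.HasZeroMorphisms C] (S : PolarizedGoI C) {At : Type w}

/-- The compatibility axiom `bangPt_zero`, taken at an identity, factors that identity through a
zero endomorphism of `1`. -/
theorem zeroTrivial_U : ZeroTrivial S.U := by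
  refine ZeroTrivial.of_retract (W := 𝟙_ C ⊗ S.U) ?_ (λ_ S.U).inv (λ_ S.U).hom (by simp)
  refine ZeroTrivial.of_factor (𝟙_ C ◁ S.rPt ≫ (α_ _ _ _).inv)
    ((α_ _ _ _).hom ≫ 𝟙_ C ◁ S.bangPt) ?_
  simpa using S.bangPt_zero (𝟙 (𝟙_ C ⊗ S.U))

/-- Uniformity is applied to the point 0 : 1 ⟶ U. -/
theorem zeroUniform_U : ZeroUniform S.U := by
  intro X Y f g h
  -- The companion over `1` discards its feedback input and returns zero. By dinaturality its trace
  -- is a trace over the unit; the composite of the two zeros survives as a zero scalar.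
  rw [S.uniform 0 f (quasiFst X S.one ≫ g ≫ quasiInl Y S.one)]
  · have : quasiFst X S.one ≫ g ≫ quasiInl Y S.one =
        (X ◁ (0 : S.one ⟶ 𝟙_ C) ≫ (ρ_ X).hom ≫ g ≫ (ρ_ Y).inv) ≫ Y ◁ (0 : 𝟙_ C ⟶ S.one) := by
      simp [quasiFst, quasiInl]
    rw [this, tr_dinaturality, ← whiskerLeft_comp_assoc, Limits.zero_comp, tr_vanishing_unit,
      quasiInl_quasiFst]
    simp only [Category.assoc, Iso.inv_hom_id, Category.comp_id]
    rw [rightUnitor_inv_naturality_assoc, ← rightUnitor_naturality, whisker_exchange_assoc]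
  · have h₀ (X : C) : X ◁ (0 : S.one ⟶ S.U) = quasiFst X S.one ≫ quasiInl X S.U := by
      simp [quasiFst, quasiInl, ← whiskerLeft_comp]
    rw [h₀ X, Category.assoc, h, Category.assoc, Category.assoc, quasiInl_whiskerLeft]

/-- α and α^* make `1` a retract of `U`, and j, k fold tensor products. Zero-uniformity and
zero-triviality thereby pass from `U` to every 𝟙_A. -/
theorem exists_retract_oneObj {p : Polarity} (A : Form At p) :
    ∃ (i : S.oneObj A ⟶ S.U) (q : S.U ⟶ S.oneObj A), i ≫ q = 𝟙 _ := by
  have h {A B : C} : (∃ (i : A ⟶ S.U) (q : S.U ⟶ A), i ≫ q = 𝟙 _) →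
      (∃ (i : B ⟶ S.U) (q : S.U ⟶ B), i ≫ q = 𝟙 _) →
      ∃ (i : A ⊗ B ⟶ S.U) (q : S.U ⟶ A ⊗ B), i ≫ q = 𝟙 _ := by
    rintro ⟨i, q, hi⟩ ⟨i', q', hi'⟩
    refine ⟨(i ⊗ₘ i') ≫ S.j, S.k ≫ (q ⊗ₘ q'), ?_⟩
    rw [Category.assoc, ← Category.assoc S.j, S.j_k, Category.id_comp, tensorHom_comp_tensorHom,
      hi, hi', id_tensorHom_id]
  induction A with
  | tensor P Q hP hQ => exact h hP hQ
  | par N M hN hM => exact h hN hM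
  | _ => exact ⟨S.pt, S.ptInv, S.pt_ptInv⟩

theorem zeroUniform_oneObj {p : Polarity} (A : Form At p) : ZeroUniform (S.oneObj A) := by
  obtain ⟨i, q, h⟩ := S.exists_retract_oneObj A
  exact ZeroUniform.of_retract S.zeroUniform_U i q h

theorem zeroTrivial_oneObj {p : Polarity} (A : Form At p) : ZeroTrivial (S.oneObj A) := by
  obtain ⟨i, q, h⟩ := S.exists_retract_oneObj A
  exact S.zeroTrivial_U.of_retract i q h

/-! ### Multipoints -/

/-- the unfolded multipoint `𝟙_A ⟶ 𝐔_A` -/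
def unfoldedMp {p : Polarity} (A : Form At p) : S.oneObj A ⟶ S.bU A :=
  S.ptPow A ≫ quasiInl (S.upperU A) (S.upperD A) ≫ (S.splitIso A).inv

theorem unfoldedMp_foldU {p : Polarity} (A : Form At p) : S.unfoldedMp A ≫ S.foldU A = S.mp A := by
  simp [unfoldedMp, mp, quasiInl]

theorem mp_unfoldU {p : Polarity} (A : Form At p) : S.mp A ≫ S.unfoldU A = S.unfoldedMp A := by
  rw [← unfoldedMp_foldU, Category.assoc, foldU_unfoldU, Category.comp_id]

theorem unfoldedMp_tensor (P Q : Form At .pos) :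
    S.unfoldedMp (.tensor P Q) = S.unfoldedMp P ⊗ₘ S.unfoldedMp Q := by
  change (S.ptPow P ⊗ₘ S.ptPow Q) ≫ quasiInl (S.upperU P ⊗ S.upperU Q) (S.upperD P ⊗ S.upperD Q) ≫
    (midIso _ _ _ _).inv ≫ ((S.splitIso P).inv ⊗ₘ (S.splitIso Q).inv) = _
  rw [reassoc_of% quasiInl_midIso_inv, tensorHom_comp_tensorHom, tensorHom_comp_tensorHom]
  rfl

theorem unfoldedMp_par (N M : Form At .neg) :
    S.unfoldedMp (.par N M) = S.unfoldedMp N ⊗ₘ S.unfoldedMp M := by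
  change (S.ptPow N ⊗ₘ S.ptPow M) ≫ quasiInl (S.upperU N ⊗ S.upperU M) (S.upperD N ⊗ S.upperD M) ≫
    (midIso _ _ _ _).inv ≫ ((S.splitIso N).inv ⊗ₘ (S.splitIso M).inv) = _
  rw [reassoc_of% quasiInl_midIso_inv, tensorHom_comp_tensorHom, tensorHom_comp_tensorHom]
  rfl

theorem unfoldedMp_down (N : Form At .neg) :
    S.unfoldedMp (.down N) = S.pt ≫ quasiInl S.U (S.bU N) :=
  congrArg (S.pt ≫ ·) (Category.comp_id _)

theorem mp_tensor (P Q : Form At .pos) : S.mp (.tensor P Q) = (S.mp P ⊗ₘ S.mp Q) ≫ S.j := by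
  rw [← unfoldedMp_foldU, ← unfoldedMp_foldU, ← unfoldedMp_foldU, unfoldedMp_tensor,
    ← tensorHom_comp_tensorHom, Category.assoc]
  rfl

theorem mp_par (N M : Form At .neg) : S.mp (.par N M) = (S.mp N ⊗ₘ S.mp M) ≫ S.j := by
  rw [← unfoldedMp_foldU, ← unfoldedMp_foldU, ← unfoldedMp_foldU, unfoldedMp_par,
    ← tensorHom_comp_tensorHom, Category.assoc]
  rfl

theorem mp_down (N : Form At .neg) : S.mp (.down N) = S.pt ≫ quasiInl S.U S.U ≫ S.j := by
  rw [← unfoldedMp_foldU, unfoldedMp_down, foldU, Category.assoc, ← Category.assoc (quasiInl _ _),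
    quasiInl_whiskerLeft]

/-- The part under the shift receives zero, so `P` leaves no trace, and the folding convention puts
the point on the left as for ↓. -/
theorem mp_up (P : Form At .pos) : S.mp (.up P) = S.pt ≫ quasiInl S.U S.U ≫ S.j := by
  change S.pt ≫ (ρ_ S.U).inv ≫ S.U ◁ (0 : 𝟙_ C ⟶ S.bU P) ≫ (β_ (S.bU P) S.U).inv ≫
    (β_ (S.bU P) S.U).hom ≫ S.U ◁ S.foldU P ≫ S.j = _
  rw [Iso.inv_hom_id_assoc, ← whiskerLeft_comp_assoc, Limits.zero_comp]
  simp [quasiInl]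

/-- At a shift both multipoints are the same morphism, independent of the formula underneath; ⊗ and
⅋ are folded alike. -/
theorem dualIso_hom_mp {p : Polarity} (A : Form At p) :
    (S.dualIso A).hom ≫ S.mp A.dual = S.mp A := by
  induction A with
  | tensor P Q hP hQ =>
    rw [mp_tensor, ← hP, ← hQ, ← tensorHom_comp_tensorHom, Category.assoc, ← mp_par]
    rfl
  | par N M hN hM =>
    rw [mp_par, ← hN, ← hM, ← tensorHom_comp_tensorHom, Category.assoc, ← mp_tensor]
    rfl
  | down N => rw [mp_down]; exact (Category.id_comp _).trans (S.mp_up N.dual)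
  | up P => rw [mp_up]; exact (Category.id_comp _).trans (S.mp_down P.dual)
  | _ => exact Category.id_comp _

/-! ### Focused interpretations -/

/-- a family of points `𝟙_A ⟶ F A` -/
abbrev Points (F : Asg At C) := ∀ p (A : Form At p), S.oneObj A ⟶ F p A

variable {S}

/-- Endomorphisms of the cut formulas that exchange dual formulas, up to morphisms that send the
points of negative formulas to those of their duals. -/
inductive CutTwist {F : Asg At C} (μ : S.Points F) :
    ∀ Δ : List (Form At .pos), (cutObj F Δ ⟶ cutObj F Δ) → Prop
  | nil : CutTwist μ [] (𝟙 _)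
  | cons {P : Form At .pos} {Δ : List (Form At .pos)} {τ} (a : F .neg P.dual ⟶ F .pos P)
      (b : F .pos P ⟶ F .neg P.dual) (ha : μ .neg P.dual ≫ a = (S.dualIso P).inv ≫ μ .pos P)
      (hτ : CutTwist μ Δ τ) : CutTwist μ (P :: Δ) (((β_ _ _).hom ≫ (a ⊗ₘ b)) ⊗ₘ τ)

theorem CutTwist.conj {F G : Asg At C} {μ : S.Points F} {ν : S.Points G} (φ : ∀ p A, F p A ⟶ G p A)
    (ψ : ∀ p A, G p A ⟶ F p A) (hφ : ∀ p A, μ p A ≫ φ p A = ν p A)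
    (hψ : ∀ p A, ν p A ≫ ψ p A = μ p A) {Δ : List (Form At .pos)} {τ} (h : CutTwist μ Δ τ) :
    CutTwist ν Δ (cutMap ψ Δ ≫ τ ≫ cutMap φ Δ) := by
  induction h with
  | nil => simpa [cutMap] using CutTwist.nil (μ := ν)
  | @cons P Δ τ a b ha hτ ih =>
    have := ih.cons (P := P) (ψ .neg P.dual ≫ a ≫ φ .pos P) (ψ .pos P ≫ b ≫ φ .neg P.dual)
      (by rw [reassoc_of% hψ, reassoc_of% ha, hφ])
    convert this using 1
    simp only [cutMap, tensorHom_comp_tensorHom, Category.assoc,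
      BraidedCategory.braiding_naturality_assoc]

theorem CutTwist.exists_of_cons {F : Asg At C} {μ : S.Points F} {P : Form At .pos}
    {Δ : List (Form At .pos)} {σ} (h : CutTwist μ (P :: Δ) σ) :
    ∃ (a : F .neg P.dual ⟶ F .pos P) (b : F .pos P ⟶ F .neg P.dual) (τ : _),
      μ .neg P.dual ≫ a = (S.dualIso P).inv ≫ μ .pos P ∧ CutTwist μ Δ τ ∧
      σ = ((β_ _ _).hom ≫ (a ⊗ₘ b)) ⊗ₘ τ := by
  cases h with
  | cons a b ha hτ => exact ⟨a, b, _, ha, hτ, rfl⟩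

/-- Splits a twist between the two premises of a binary rule. -/
theorem CutTwist.append {F : Asg At C} {μ : S.Points F} : ∀ {Δ Δ' : List (Form At .pos)} {τ},
    CutTwist μ (Δ ++ Δ') τ → ∃ τ₁ τ₂, CutTwist μ Δ τ₁ ∧ CutTwist μ Δ' τ₂ ∧
      τ ≫ (cutAppend F Δ Δ').hom = (cutAppend F Δ Δ').hom ≫ (τ₁ ⊗ₘ τ₂)
  | [], Δ', τ, h => ⟨_, τ, .nil, h, by simp [cutAppend]⟩
  | P :: Δ, Δ', _, .cons a b ha hτ => by
    obtain ⟨τ₁, τ₂, h₁, h₂, e⟩ := CutTwist.append hτ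
    refine ⟨_, τ₂, .cons a b ha h₁, h₂, ?_⟩
    simp only [cutAppend, Iso.trans_hom, MonoidalCategory.tensorIso_hom, Iso.refl_hom,
      Iso.symm_hom, Category.assoc]
    rw [← associator_inv_naturality, tensorHom_comp_tensorHom_assoc,
      tensorHom_comp_tensorHom_assoc, e, Category.comp_id, Category.id_comp]

/-- After tracing out the cut formulas, `x` takes the point `m` of the left factor to the point `p`
of the right factor along `g`. -/
def Focused {F : Asg At C} (μ : S.Points F) (Δ : List (Form At .pos)) {Z A W n : C} (m : Z ⟶ A)
    (p : W ⟶ n) (x : (A ⊗ n) ⊗ cutObj F Δ ⟶ (A ⊗ n) ⊗ cutObj F Δ) (g : Z ⟶ W) : Prop :=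
  ∀ τ, CutTwist μ Δ τ →
    m ≫ quasiInl A n ≫ tr (cutObj F Δ) (x ≫ (A ⊗ n) ◁ τ) = g ≫ p ≫ quasiInr A n

section Focused

variable {F G : Asg At C} {μ : S.Points F} {ν : S.Points G} {Δ Δ' : List (Form At .pos)}

/-- The maps on the cut formulas go around the trace and turn the twist into another twist
(`CutTwist.conj`). The input map `h` on the right factor and the output map `f'` on the left one are
unconstrained, because they meet only zeros. -/
theorem Focused.conj {Z A A' W W' n n' : C} {m : Z ⟶ A} {p : W ⟶ n} {x} {g : Z ⟶ W}
    (hx : Focused ν Δ m p x g) (φ : ∀ p A, F p A ⟶ G p A)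
    (ψ : ∀ p A, G p A ⟶ F p A) (hφ : ∀ p A, μ p A ≫ φ p A = ν p A)
    (hψ : ∀ p A, ν p A ≫ ψ p A = μ p A) {m' : Z ⟶ A'} {f : A' ⟶ A} (f' : A ⟶ A') (h : n' ⟶ n)
    {h' : n ⟶ n'} {p' : W' ⟶ n'} {g' : Z ⟶ W'} (hm : m' ≫ f = m) (hp : g ≫ p ≫ h' = g' ≫ p') :
    Focused μ Δ m' p' (((f ⊗ₘ h) ⊗ₘ cutMap φ Δ) ≫ x ≫ ((f' ⊗ₘ h') ⊗ₘ cutMap ψ Δ)) g' := by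
  intro τ hτ
  have : (((f ⊗ₘ h) ⊗ₘ cutMap φ Δ) ≫ x ≫ ((f' ⊗ₘ h') ⊗ₘ cutMap ψ Δ)) ≫ (A' ⊗ n') ◁ τ =
      ((f ⊗ₘ h) ⊗ₘ cutMap φ Δ) ≫ x ≫ ((f' ⊗ₘ h') ⊗ₘ (cutMap ψ Δ ≫ τ)) := by
    rw [Category.assoc, Category.assoc, ← id_tensorHom, tensorHom_comp_tensorHom, Category.comp_id]
  rw [this, tr_conj, ← Category.assoc (quasiInl _ _), quasiInl_naturality, Category.assoc,
    Category.assoc, reassoc_of% hm]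
  rw [reassoc_of% hx _ (hτ.conj φ ψ hφ hψ), quasiInr_naturality, reassoc_of% hp]

theorem Focused.conj_id {Z A A' W W' n n' : C} {m : Z ⟶ A} {p : W ⟶ n} {x} {g : Z ⟶ W}
    (hx : Focused μ Δ m p x g) {m' : Z ⟶ A'} {f : A' ⟶ A} (f' : A ⟶ A') (h : n' ⟶ n)
    {h' : n ⟶ n'} {p' : W' ⟶ n'} {g' : Z ⟶ W'} (hm : m' ≫ f = m) (hp : g ≫ p ≫ h' = g' ≫ p') :
    Focused μ Δ m' p' ((f ⊗ₘ h) ▷ cutObj F Δ ≫ x ≫ (f' ⊗ₘ h') ▷ cutObj F Δ) g' := by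
  have := hx.conj (μ := μ) (fun p A => 𝟙 (F p A)) (fun p A => 𝟙 (F p A)) (by simp) (by simp) f' h
    hm hp
  simpa only [cutMap_id, tensorHom_id] using this

theorem Focused.tensor {Z₁ A₁ W₁ n₁ Z₂ A₂ W₂ n₂ : C} {m₁ : Z₁ ⟶ A₁} {p₁ : W₁ ⟶ n₁} {x₁}
    {g₁ : Z₁ ⟶ W₁} {m₂ : Z₂ ⟶ A₂} {p₂ : W₂ ⟶ n₂} {x₂} {g₂ : Z₂ ⟶ W₂}
    (h₁ : Focused μ Δ m₁ p₁ x₁ g₁) (h₂ : Focused μ Δ' m₂ p₂ x₂ g₂) :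
    Focused μ (Δ ++ Δ') (m₁ ⊗ₘ m₂) (p₁ ⊗ₘ p₂)
      (((A₁ ⊗ A₂) ⊗ (n₁ ⊗ n₂)) ◁ (cutAppend F Δ Δ').hom ≫
        (tensorTau A₁ A₂ n₁ n₂ (cutObj F Δ) (cutObj F Δ')).hom ≫ (x₁ ⊗ₘ x₂) ≫
        (tensorTau A₁ A₂ n₁ n₂ (cutObj F Δ) (cutObj F Δ')).inv ≫
        ((A₁ ⊗ A₂) ⊗ (n₁ ⊗ n₂)) ◁ (cutAppend F Δ Δ').inv) (g₁ ⊗ₘ g₂) := by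
  intro τ hτ
  obtain ⟨τ₁, τ₂, hτ₁, hτ₂, e⟩ := hτ.append
  have := tr_transport (cutAppend F Δ Δ') e ((tensorTau A₁ A₂ n₁ n₂ (cutObj F Δ)
    (cutObj F Δ')).hom ≫ (x₁ ⊗ₘ x₂) ≫ (tensorTau A₁ A₂ n₁ n₂ (cutObj F Δ) (cutObj F Δ')).inv)
  simp only [Category.assoc] at this ⊢
  rw [this]
  rw [tr_tensorTau, reassoc_of% quasiInl_midIso_hom,
    tensorHom_comp_tensorHom_assoc, tensorHom_comp_tensorHom_assoc, Category.assoc m₁,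
    Category.assoc m₂, h₁ _ hτ₁, h₂ _ hτ₂, ← tensorHom_comp_tensorHom, ← tensorHom_comp_tensorHom,
    Category.assoc, Category.assoc, ← quasiInr_midIso_hom, Category.assoc, Iso.hom_inv_id,
    Category.comp_id]

/-- `tr_cut` with the traced premises as `F` and `G`: the right premise yields `g₂`, and the twist
turns its component at P^⊥ into a point of P, on which the left premise acts by `g₁`. -/
theorem Focused.cut {P : Form At .pos} {W n Z A x : C} {W' : C} {p : W ⟶ n} {x₁}
    {g₁ : S.oneObj P ⟶ W} {m : Z ⟶ A} {p' : W' ⟶ x} {x₂}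
    {g₂ : Z ⟶ S.oneObj P.dual ⊗ W'} (hF : ZeroUniform (F .neg P.dual)) (hA : ZeroTrivial A)
    (h₁ : Focused μ Δ (μ .pos P) p x₁ g₁)
    (h₂ : Focused μ Δ' m (μ .neg P.dual ⊗ₘ p') x₂ g₂) :
    Focused μ (P :: (Δ ++ Δ')) m (p ⊗ₘ p')
      ((A ⊗ (n ⊗ x)) ◁ ((F .pos P ⊗ F .neg P.dual) ◁ (cutAppend F Δ Δ').hom) ≫
        (cutTau A n x (F .pos P) (F .neg P.dual) (cutObj F Δ) (cutObj F Δ')).hom ≫ (x₁ ⊗ₘ x₂) ≫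
        (cutTau A n x (F .pos P) (F .neg P.dual) (cutObj F Δ) (cutObj F Δ')).inv ≫
        (A ⊗ (n ⊗ x)) ◁ ((F .pos P ⊗ F .neg P.dual) ◁ (cutAppend F Δ Δ').inv))
      (g₂ ≫ ((S.dualIso P).inv ≫ g₁) ▷ W') := by
  intro _ h₀
  obtain ⟨a, b, τ, ha, hτ, rfl⟩ := h₀.exists_of_cons
  obtain ⟨τ₁, τ₂, hτ₁, hτ₂, e⟩ := hτ.append
  have e' : (((β_ (F .pos P) (F .neg P.dual)).hom ≫ (a ⊗ₘ b)) ⊗ₘ τ) ≫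
      (whiskerLeftIso (F .pos P ⊗ F .neg P.dual) (cutAppend F Δ Δ')).hom =
      (whiskerLeftIso (F .pos P ⊗ F .neg P.dual) (cutAppend F Δ Δ')).hom ≫
        (((β_ (F .pos P) (F .neg P.dual)).hom ≫ (a ⊗ₘ b)) ⊗ₘ (τ₁ ⊗ₘ τ₂)) := by
    simp only [whiskerLeftIso_hom, ← id_tensorHom, tensorHom_comp_tensorHom, e, Category.id_comp,
      Category.comp_id]
  have := tr_transport _ e' ((cutTau A n x (F .pos P) (F .neg P.dual) (cutObj F Δ)
    (cutObj F Δ')).hom ≫ (x₁ ⊗ₘ x₂) ≫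
      (cutTau A n x (F .pos P) (F .neg P.dual) (cutObj F Δ) (cutObj F Δ')).inv)
  simp only [Category.assoc, whiskerLeftIso_hom, whiskerLeftIso_inv] at this ⊢
  rw [this, tr_cutTau]
  have h := h₁ _ hτ₁
  rw [tr_cut hF hA b (w := g₂ ≫ (μ .neg P.dual ⊗ₘ p'))
    (w' := (g₂ ≫ ((S.dualIso P).inv ≫ g₁) ▷ W') ≫ (p ⊗ₘ p'))]
  · simp only [Category.assoc]
  · rw [h₂ _ hτ₂, Category.assoc]
  · simp only [Category.assoc, ← tensorHom_id, tensorHom_comp_tensorHom, reassoc_of% ha]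
    rw [h]
    simp

end Focused

end PolarizedGoI

namespace PolarizedGoI

open SymmCoherence TracedCategory

variable {C : Type u} [Category.{v} C] [MonoidalCategory C] [SymmetricCategory C]
  [TracedCategory C] [Limits.HasZeroMorphisms C] {S : PolarizedGoI C} {At : Type w}

/-! ### The rules preserve focusing -/

section

variable {F G : Asg At C} {μ : S.Points F} {ν : S.Points G} {Δ Δ' : List (Form At .pos)}

theorem Focused.ax {A B Z W : C} {m : Z ⟶ A} {p : W ⟶ B} {g : Z ⟶ W} (a : B ⟶ A) {b : A ⟶ B}
    (h : m ≫ b = g ≫ p) :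
    Focused μ [] m (p ⊗ₘ 𝟙 (𝟙_ C))
      ((axTau A B).hom ≫ ((β_ A B).hom ≫ (a ⊗ₘ b)) ≫ (axTau A B).inv) (g ≫ (ρ_ W).inv) := by
  intro τ hτ
  cases hτ
  have h₁ : quasiInl A (B ⊗ 𝟙_ C) ≫ (ρ_ _).inv ≫ (axTau A B).hom ≫ (β_ A B).hom =
      quasiInr B A := by
    simp only [axTau, Iso.trans_hom, MonoidalCategory.tensorIso_hom, Iso.refl_hom]
    exact Structural.unique (atoms A B A A A A A A) (by decide)
  have h₂ : quasiInr A B ≫ (axTau A B).inv ≫ (ρ_ _).hom = (ρ_ B).inv ≫ quasiInr A (B ⊗ 𝟙_ C) := by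
    simp only [axTau, Iso.trans_inv, MonoidalCategory.tensorIso_inv, Iso.refl_inv]
    exact Structural.unique (atoms A B A A A A A A) (by decide)
  rw [tr_vanishing_unit, whiskerLeft_id, Category.comp_id]
  simp only [Category.assoc]
  rw [reassoc_of% h₁, ← Category.assoc (quasiInr B A), quasiInr_naturality, Category.assoc, h₂,
    reassoc_of% h, tensorHom_id, ← rightUnitor_inv_naturality_assoc]

/-- Only `T` carries a nonzero input. The traced premise and `v` act on zeros and vanish, whatever
they are, so the sole output is that of `u` on `W`. -/
theorem Focused.down {T N n W Z : C} (t : Z ⟶ T) (u : T ⟶ W) (v : W ⟶ T)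
    (x : (𝟙_ C ⊗ (N ⊗ n)) ⊗ cutObj F Δ ⟶ (𝟙_ C ⊗ (N ⊗ n)) ⊗ cutObj F Δ) :
    Focused μ Δ (t ≫ quasiInl T N) (quasiInr n W)
      ((downTau T N n W (cutObj F Δ)).hom ≫ (u ⊗ₘ (x ⊗ₘ v)) ≫
        (outerSwap W ((𝟙_ C ⊗ (N ⊗ n)) ⊗ cutObj F Δ) T).hom ≫
        (downTau T N n W (cutObj F Δ)).inv) (t ≫ u) := by
  intro τ _
  have h₁ : quasiInl T N ≫ quasiInl (T ⊗ N) (n ⊗ W) ≫ (α_ T N (n ⊗ W)).hom ≫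
      T ◁ ((α_ N n W).inv ≫ (λ_ (N ⊗ n)).inv ▷ W) = quasiInl T ((𝟙_ C ⊗ (N ⊗ n)) ⊗ W) :=
    Structural.unique (atoms T N n W T T T T) (by decide)
  have h₂ : quasiInl W ((𝟙_ C ⊗ (N ⊗ n)) ⊗ T) ≫ (outerSwap W (𝟙_ C ⊗ (N ⊗ n)) T).hom ≫
      T ◁ ((λ_ (N ⊗ n)).hom ▷ W ≫ (α_ N n W).hom) ≫ (α_ T N (n ⊗ W)).inv =
      quasiInr n W ≫ quasiInr (T ⊗ N) (n ⊗ W) := by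
    simp only [outerSwap, Iso.trans_hom, MonoidalCategory.tensorIso_hom, Iso.refl_hom]
    exact Structural.unique (atoms T N n W T T T T) (by decide)
  simp only [Category.assoc]
  rw [tr_downTau, Category.assoc, reassoc_of% h₁, ← Category.assoc (quasiInl T _),
    quasiInl_naturality, Category.assoc, h₂]

theorem Focused.map {𝒩 : List (Form At .neg)} {P : Form At .pos} {x} {g : S.oneObj P ⟶ _}
    (hx : Focused ν Δ (ν .pos P) (negMap ν 𝒩) x g) (φ : ∀ p A, F p A ⟶ G p A)
    (ψ : ∀ p A, G p A ⟶ F p A) (hφ : ∀ p A, μ p A ≫ φ p A = ν p A)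
    (hψ : ∀ p A, ν p A ≫ ψ p A = μ p A) :
    Focused μ Δ (μ .pos P) (negMap μ 𝒩)
      (ifaceMap φ Δ 𝒩 (some P) ≫ x ≫ ifaceMap ψ Δ 𝒩 (some P)) g := by
  refine hx.conj φ ψ hφ hψ (ψ .pos P) (negMap φ 𝒩) (hφ _ _) ?_
  rw [negMap_comp_negMap]
  simp only [hψ]

theorem Focused.exch {𝒩 𝒩' : List (Form At .neg)} (e : Exch 𝒩 𝒩') {P : Form At .pos} {x}
    {g : S.oneObj P ⟶ _} (hx : Focused μ Δ (μ .pos P) (negMap μ 𝒩) x g) :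
    Focused μ Δ (μ .pos P) (negMap μ 𝒩')
      ((exchIface F Δ e (some P)).hom ≫ x ≫ (exchIface F Δ e (some P)).inv)
      (g ≫ (exchIso S.asgOne e).hom) := by
  have := hx.conj_id (f := 𝟙 _) (𝟙 _) (exchIso F e).inv (h' := (exchIso F e).hom)
    (Category.comp_id _) (p' := negMap μ 𝒩') (g' := g ≫ (exchIso S.asgOne e).hom)
    (by rw [negMap_exchIso, Category.assoc])
  simpa only [exchIface, MonoidalCategory.tensorIso_hom, MonoidalCategory.tensorIso_inv,
    Iso.refl_hom, Iso.refl_inv, Iso.symm_hom, Iso.symm_inv, tensorHom_id] using this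

theorem Focused.cutIface {𝒩 Ξ : List (Form At .neg)} {P Q : Form At .pos}
    (hP : ZeroUniform (F .neg P.dual)) (hQ : ZeroTrivial (F .pos Q)) {x y}
    {g : S.oneObj P ⟶ _} {g' : S.oneObj Q ⟶ _}
    (hx : Focused μ Δ (μ .pos P) (negMap μ 𝒩) x g)
    (hy : Focused μ Δ' (μ .pos Q) (negMap μ (P.dual :: Ξ)) y g') :
    Focused μ (P :: (Δ ++ Δ')) (μ .pos Q) (negMap μ (𝒩 ++ Ξ))
      ((cutIface F Δ Δ' 𝒩 Ξ (some Q) P).hom ≫ (x ⊗ₘ y) ≫ (cutIface F Δ Δ' 𝒩 Ξ (some Q) P).inv)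
      ((g' ≫ ((S.dualIso P).inv ≫ g) ▷ negObj S.asgOne Ξ) ≫ (negAppend S.asgOne 𝒩 Ξ).inv) := by
  have := (hx.cut hP hQ hy).conj_id (f := 𝟙 _) (𝟙 _) (negAppend F 𝒩 Ξ).hom
    (h' := (negAppend F 𝒩 Ξ).inv) (Category.comp_id _) (p' := negMap μ (𝒩 ++ Ξ))
    (g' := (g' ≫ ((S.dualIso P).inv ≫ g) ▷ negObj S.asgOne Ξ) ≫ (negAppend S.asgOne 𝒩 Ξ).inv) (by
      rw [Category.assoc _ (negAppend S.asgOne 𝒩 Ξ).inv]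
      congr 1
      rw [Iso.comp_inv_eq, Category.assoc, negMap_append, Iso.inv_hom_id_assoc])
  simpa only [_root_.cutIface, Iso.trans_hom, Iso.trans_inv, MonoidalCategory.tensorIso_hom,
    MonoidalCategory.tensorIso_inv, Iso.refl_hom, Iso.refl_inv, id_tensorHom,
    MonoidalCategory.tensorHom_def (_ ◁ (negAppend F 𝒩 Ξ).hom) (_ ◁ _),
    MonoidalCategory.tensorHom_def' (_ ◁ (negAppend F 𝒩 Ξ).inv) (_ ◁ _), Category.assoc] using this

theorem Focused.tensorIface {ℳ 𝒩 : List (Form At .neg)} {P Q : Form At .pos} {x y}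
    {g : S.oneObj P ⟶ _} {g' : S.oneObj Q ⟶ _}
    (hx : Focused μ Δ (μ .pos P) (negMap μ ℳ) x g)
    (hy : Focused μ Δ' (μ .pos Q) (negMap μ 𝒩) y g') :
    Focused μ (Δ ++ Δ') (μ .pos P ⊗ₘ μ .pos Q) (negMap μ (ℳ ++ 𝒩))
      ((tensorIface F Δ Δ' ℳ 𝒩 P Q).hom ≫ (x ⊗ₘ y) ≫ (tensorIface F Δ Δ' ℳ 𝒩 P Q).inv)
      ((g ⊗ₘ g') ≫ (negAppend S.asgOne ℳ 𝒩).inv) := by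
  have := (hx.tensor hy).conj_id (f := 𝟙 _) (𝟙 _) (negAppend F ℳ 𝒩).hom
    (h' := (negAppend F ℳ 𝒩).inv) (Category.comp_id _) (p' := negMap μ (ℳ ++ 𝒩))
    (g' := (g ⊗ₘ g') ≫ (negAppend S.asgOne ℳ 𝒩).inv) (by
      rw [Category.assoc]
      congr 1
      rw [Iso.comp_inv_eq, Category.assoc, negMap_append, Iso.inv_hom_id_assoc])
  simpa only [_root_.tensorIface, Iso.trans_hom, Iso.trans_inv, MonoidalCategory.tensorIso_hom,
    MonoidalCategory.tensorIso_inv, Iso.refl_hom, Iso.refl_inv, id_tensorHom,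
    MonoidalCategory.tensorHom_def (_ ◁ _) (cutAppend F Δ Δ').hom,
    MonoidalCategory.tensorHom_def' (_ ◁ (negAppend F ℳ 𝒩).inv) (cutAppend F Δ Δ').inv,
    Category.assoc] using this

theorem Focused.par {𝒩 : List (Form At .neg)} {P : Form At .pos} {N M : Form At .neg} {x}
    {g : S.oneObj P ⟶ _} (hx : Focused μ Δ (μ .pos P) (negMap μ (N :: M :: 𝒩)) x g) :
    Focused μ Δ (μ .pos P) ((μ .neg N ⊗ₘ μ .neg M) ⊗ₘ negMap μ 𝒩)
      ((parTau (F .pos P) (F .neg N) (F .neg M) (negObj F 𝒩) (cutObj F Δ)).hom ≫ x ≫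
        (parTau (F .pos P) (F .neg N) (F .neg M) (negObj F 𝒩) (cutObj F Δ)).inv)
      (g ≫ (α_ _ _ _).inv) := by
  have := hx.conj_id (f := 𝟙 _) (𝟙 _) (α_ _ _ _).hom (h' := (α_ _ _ _).inv)
    (Category.comp_id _) (p' := (μ .neg N ⊗ₘ μ .neg M) ⊗ₘ negMap μ 𝒩)
    (g' := g ≫ (α_ _ _ _).inv)
    (by simp only [negMap, associator_inv_naturality, Category.assoc])
  simpa only [parTau, MonoidalCategory.tensorIso_hom, MonoidalCategory.tensorIso_inv,
    Iso.refl_hom, Iso.refl_inv, tensorHom_id] using this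

end

/-! ### Zero inputs of the retractions -/

variable (S)

/-- A zero input to `U` factors as a zero into `1` followed by α, and !_α restricted along α is !
followed by α. In this way !_A turns an output on 𝟙_A into the point of A. -/
theorem quasiInr_bangU {p : Polarity} (A : Form At p) :
    quasiInr (S.upperU A) (S.oneObj A) ≫ S.bangU A =
      quasiInr (S.oneObj A) (S.oneObj A) ≫ S.bangPow A ≫ S.ptPow A := by
  have atomic : quasiInr S.U S.one ≫ S.bangPt = quasiInr S.one S.one ≫ S.bang ≫ S.pt := by
    rw [← S.pt_bangPt, ← Category.assoc, quasiInr_whiskerRight]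
  have product {p q : Polarity} {A : Form At p} {B : Form At q}
      (hA : quasiInr (S.upperU A) (S.oneObj A) ≫ S.bangU A =
        quasiInr (S.oneObj A) (S.oneObj A) ≫ S.bangPow A ≫ S.ptPow A)
      (hB : quasiInr (S.upperU B) (S.oneObj B) ≫ S.bangU B =
        quasiInr (S.oneObj B) (S.oneObj B) ≫ S.bangPow B ≫ S.ptPow B) :
      quasiInr (S.upperU A ⊗ S.upperU B) (S.oneObj A ⊗ S.oneObj B) ≫
        (midIso _ _ _ _).inv ≫ (S.bangU A ⊗ₘ S.bangU B) =
      quasiInr (S.oneObj A ⊗ S.oneObj B) (S.oneObj A ⊗ S.oneObj B) ≫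
        ((midIso _ _ _ _).inv ≫ (S.bangPow A ⊗ₘ S.bangPow B)) ≫ (S.ptPow A ⊗ₘ S.ptPow B) := by
    rw [Category.assoc, reassoc_of% quasiInr_midIso_inv, reassoc_of% quasiInr_midIso_inv,
      tensorHom_comp_tensorHom, tensorHom_comp_tensorHom, tensorHom_comp_tensorHom, hA, hB]
  induction A with
  | tensor P Q hP hQ => exact product hP hQ
  | par N M hN hM => exact product hN hM
  | _ => exact atomic

theorem quasiInr_bangHat {p : Polarity} (A : Form At p) :
    quasiInr (S.bU A) (S.oneObj A) ≫ S.bangHat A =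
      quasiInr (S.oneObj A) (S.oneObj A) ≫ S.bangPow A ≫ S.unfoldedMp A := by
  have h (X Y Z : C) : quasiInr (X ⊗ Y) Z ≫ (α_ X Y Z).hom ≫ X ◁ (β_ Y Z).hom ≫ (α_ X Z Y).inv =
      quasiInr X Z ≫ quasiInl (X ⊗ Z) Y :=
    Structural.unique (atoms X Y Z X X X X X) (by decide)
  rw [bangHat, ← Category.assoc (quasiInr _ _), quasiInr_whiskerRight, reassoc_of% h,
    ← Category.assoc (quasiInl _ _), quasiInl_whiskerRight, Category.assoc,
    reassoc_of% S.quasiInr_bangU A, unfoldedMp]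

theorem quasiInr_bangHatSeq : ∀ ℳ : List (Form At .neg),
    quasiInr (negObj S.asgB ℳ) (negObj S.asgOne ℳ) ≫ S.bangHatSeq ℳ =
      quasiInr (negObj S.asgOne ℳ) (negObj S.asgOne ℳ) ≫ S.bangPowSeq ℳ ≫
        negMap (F := S.asgOne) (G := S.asgB) (fun _ A => S.unfoldedMp A) ℳ
  | [] => by simp [bangHatSeq, bangPowSeq, negMap]
  | N :: ℳ => by
    simp only [bangHatSeq, bangPowSeq, negMap, Category.assoc]
    rw [reassoc_of% quasiInr_midIso_inv, reassoc_of% quasiInr_midIso_inv,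
      tensorHom_comp_tensorHom, tensorHom_comp_tensorHom, tensorHom_comp_tensorHom,
      quasiInr_bangHatSeq ℳ, quasiInr_bangHat]

/-! ### Interpretations of proofs are focused -/

theorem symOne_eq (P : Form At .pos) :
    S.symOne P = (β_ _ _).hom ≫ ((S.dualIso P).inv ⊗ₘ (S.dualIso P).hom) := by
  rw [symOne, BraidedCategory.braiding_naturality]

/-- Both `a` and `b` are identities; the required equation is the equality of dual multipoints. -/
theorem cutTwist_sigma : ∀ Δ : List (Form At .pos),
    CutTwist (S := S) (F := S.asgU) (fun _ A => S.mp A) Δ (S.sigma Δ)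
  | [] => .nil
  | P :: Δ => by
    have := CutTwist.cons (S := S) (F := S.asgU) (μ := fun _ A => S.mp A) (P := P) (𝟙 S.U) (𝟙 S.U)
      (by rw [Category.comp_id, Iso.eq_inv_comp, dualIso_hom_mp]) (cutTwist_sigma Δ)
    rwa [id_tensorHom_id, Category.comp_id] at this

theorem cutTwist_sigmaStar : ∀ Δ : List (Form At .pos),
    CutTwist (S := S) (F := S.asgOne) (fun _ A => 𝟙 (S.oneObj A)) Δ (S.sigmaStar Δ)
  | [] => .nil
  | P :: Δ => by
    have := CutTwist.cons (S := S) (F := S.asgOne) (μ := fun _ A => 𝟙 (S.oneObj A)) (P := P)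
      (S.dualIso P).inv (S.dualIso P).hom (by rw [Category.comp_id, Category.id_comp])
      (cutTwist_sigmaStar Δ)
    rwa [← symOne_eq] at this

/-- The two layers of the interpretation of a proof with a positive conclusion are focused along the
same morphism. -/
def FocusedLayers {Δ : List (Form At .pos)} {𝒩 : List (Form At .neg)} :
    ∀ {Θ : Option (Form At .pos)}, (iface S.asgOne Δ 𝒩 Θ ⟶ iface S.asgOne Δ 𝒩 Θ) →
      (iface S.asgU Δ 𝒩 Θ ⟶ iface S.asgU Δ 𝒩 Θ) → Prop
  | none, _, _ => True
  | some P, y, x => ∃ g : S.oneObj P ⟶ negObj S.asgOne 𝒩,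
      Focused (S := S) (F := S.asgOne) (fun _ A => 𝟙 (S.oneObj A)) Δ (𝟙 (S.oneObj P))
        (negMap (F := S.asgOne) (G := S.asgOne) (fun _ A => 𝟙 (S.oneObj A)) 𝒩) y g ∧
      Focused (S := S) (F := S.asgU) (fun _ A => S.mp A) Δ (S.mp P)
        (negMap (F := S.asgOne) (G := S.asgU) (fun _ A => S.mp A) 𝒩) x g

variable {S}

theorem Focused.dagger {Δ : List (Form At .pos)} {𝒩 : List (Form At .neg)} {P : Form At .pos} {x}
    {g : S.oneObj P ⟶ _}
    (hx : Focused (S := S) (F := S.asgU) (fun _ A => S.mp A) Δ (S.mp P)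
      (negMap (F := S.asgOne) (G := S.asgU) (fun _ A => S.mp A) 𝒩) x g) :
    Focused (S := S) (F := S.asgB) (fun _ A => S.unfoldedMp A) Δ (S.unfoldedMp P)
      (negMap (F := S.asgOne) (G := S.asgB) (fun _ A => S.unfoldedMp A) 𝒩)
      (S.dagger Δ 𝒩 (some P) x) g :=
  hx.map (F := S.asgB) (G := S.asgU) (μ := fun _ A => S.unfoldedMp A) (ν := fun _ A => S.mp A)
    (fun _ A => S.foldU A) (fun _ A => S.unfoldU A)
    (fun _ A => S.unfoldedMp_foldU A) (fun _ A => S.mp_unfoldU A)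

theorem Focused.undagger {Δ : List (Form At .pos)} {𝒩 : List (Form At .neg)} {P : Form At .pos} {x}
    {g : S.oneObj P ⟶ _}
    (hx : Focused (S := S) (F := S.asgB) (fun _ A => S.unfoldedMp A) Δ (S.unfoldedMp P)
      (negMap (F := S.asgOne) (G := S.asgB) (fun _ A => S.unfoldedMp A) 𝒩) x g) :
    Focused (S := S) (F := S.asgU) (fun _ A => S.mp A) Δ (S.mp P)
      (negMap (F := S.asgOne) (G := S.asgU) (fun _ A => S.mp A) 𝒩)
      (S.undagger Δ 𝒩 (some P) x) g :=
  hx.map (F := S.asgU) (G := S.asgB) (μ := fun _ A => S.mp A) (ν := fun _ A => S.unfoldedMp A)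
    (fun _ A => S.unfoldU A) (fun _ A => S.foldU A)
    (fun _ A => S.mp_unfoldU A) (fun _ A => S.unfoldedMp_foldU A)

variable (S)

theorem focusedLayers_down {Δ : List (Form At .pos)} {ℳ : List (Form At .neg)} (N : Form At .neg)
    (y : iface S.asgOne Δ (N :: ℳ) none ⟶ iface S.asgOne Δ (N :: ℳ) none)
    (x : iface S.asgB Δ (N :: ℳ) none ⟶ iface S.asgB Δ (N :: ℳ) none) :
    S.FocusedLayers (Θ := some (.down N)) (S.downLower Δ ℳ N y)
      (S.undagger Δ ℳ (some (.down N)) (S.downUpper Δ ℳ N x)) := by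
  -- The common witness: h_m, then !^m with zero in its first argument. Above, α followed by α^*
  -- cancels, and the final !̂ contributes this !^m followed by the multipoints.
  refine ⟨S.hSeq ℳ ≫ quasiInr (negObj S.asgOne ℳ) (negObj S.asgOne ℳ) ≫ S.bangPowSeq ℳ,
    ?_, Focused.undagger ?_⟩
  · have := (Focused.down (μ := fun _ A => 𝟙 (S.oneObj A)) (𝟙 S.one) (S.hSeq ℳ) (S.gSeq ℳ)
      (((𝟙_ C ◁ ((0 : 𝟙_ C ⟶ S.oneObj N) ▷ negObj S.asgOne ℳ)) ▷ cutObj S.asgOne Δ) ≫ y ≫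
        ((𝟙_ C ◁ ((0 : S.oneObj N ⟶ 𝟙_ C) ▷ negObj S.asgOne ℳ)) ▷ cutObj S.asgOne Δ))).conj_id
      (m' := 𝟙 S.one) (f := (ρ_ S.one).inv) (ρ_ S.one).hom (S.rPowSeq ℳ) (h' := S.bangPowSeq ℳ)
      (p' := negMap (F := S.asgOne) (G := S.asgOne) (fun _ A => 𝟙 (S.oneObj A)) ℳ)
      (g' := S.hSeq ℳ ≫ quasiInr (negObj S.asgOne ℳ) (negObj S.asgOne ℳ) ≫ S.bangPowSeq ℳ)
      (by
        -- Below, the place of N is taken by the unit, so the quasi-injection differs from the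
        -- inverse unitor by a zero scalar acting on `1`.
        have h : S.one ◁ (0 : 𝟙_ C ⟶ 𝟙_ C) = 𝟙 _ := S.zeroTrivial_oneObj (.down N)
        rw [quasiInl, h, Category.comp_id])
      (by
        rw [negMap_id, Category.comp_id, Category.id_comp])
    simpa only [Category.assoc, downLower] using this
  · have := (Focused.down (μ := fun _ A => S.unfoldedMp A) S.pt (S.ptInv ≫ S.hSeq ℳ)
      (S.gSeq ℳ ≫ S.pt) x).conj_id (f := 𝟙 _) (𝟙 _) (S.rHatSeq ℳ) (h' := S.bangHatSeq ℳ)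
      (Category.comp_id _)
      (p' := negMap (F := S.asgOne) (G := S.asgB) (fun _ A => S.unfoldedMp A) ℳ)
      (g' := S.hSeq ℳ ≫ quasiInr (negObj S.asgOne ℳ) (negObj S.asgOne ℳ) ≫ S.bangPowSeq ℳ)
      (by rw [← Category.assoc S.pt, S.pt_ptInv, Category.id_comp, quasiInr_bangHatSeq,
            Category.assoc, Category.assoc])
    rw [unfoldedMp_down]
    simpa only [Category.assoc, downUpper, id_tensorHom] using this

/-- Nothing is claimed about sequents without a positive formula. Among the rules with a positive
formula in the conclusion, only ↓ has such a premise, and its case needs no information about it. -/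
theorem focusedLayers {Δ : List (Form At .pos)} {𝒩 : List (Form At .neg)}
    {Θ : Option (Form At .pos)} (π : Proof Δ 𝒩 Θ) : S.FocusedLayers (S.lower π) (S.upper π) := by
  induction π with
  | ax P =>
    refine ⟨(S.dualIso P).hom ≫ (ρ_ _).inv, ?_, ?_⟩
    · have := Focused.ax (F := S.asgOne (At := At)) (μ := fun _ A => 𝟙 (S.oneObj A))
        (m := 𝟙 (S.oneObj P))
        (p := 𝟙 (S.oneObj P.dual)) (g := (S.dualIso P).hom) (S.dualIso P).inv
        (b := (S.dualIso P).hom) (by rw [Category.comp_id, Category.id_comp])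
      rwa [← symOne_eq] at this
    · have := Focused.ax (F := S.asgU (At := At)) (μ := fun _ A => S.mp A) (m := S.mp P)
        (p := S.mp P.dual) (g := (S.dualIso P).hom) (𝟙 S.U)
        (b := 𝟙 S.U) (by rw [Category.comp_id, dualIso_hom_mp])
      rwa [id_tensorHom_id, Category.comp_id] at this
  | @exch Δ 𝒩 𝒩' Θ e π ih =>
    cases Θ with
    | none => trivial
    | some P =>
      obtain ⟨g, hl, hu⟩ := ih
      exact ⟨_, hl.exch e, hu.exch e⟩
  | @cut Δ' Δ'' 𝒩 Ξ Θ P π' π'' ih' ih'' =>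
    cases Θ with
    | none => trivial
    | some Q =>
      obtain ⟨g, hl, hu⟩ := ih'
      obtain ⟨g', hl', hu'⟩ := ih''
      -- Cut acts on folded interfaces, so zero-uniformity is needed only for the objects 𝟙_A and
      -- `U`. Both layers produce the same witness.
      exact ⟨_, hl.cutIface (S.zeroUniform_oneObj _) (S.zeroTrivial_oneObj _) hl',
        hu.cutIface S.zeroUniform_U S.zeroTrivial_U hu'⟩
  | @tensor Δ' Δ'' ℳ 𝒩 P Q π' π'' ih' ih'' =>
    obtain ⟨g, hl, hu⟩ := ih'
    obtain ⟨g', hl', hu'⟩ := ih''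
    refine ⟨(g ⊗ₘ g') ≫ (negAppend S.asgOne ℳ 𝒩).inv, ?_, Focused.undagger ?_⟩
    rotate_left
    · rw [unfoldedMp_tensor]
      exact hu.dagger.tensorIface hu'.dagger
    · have := hl.tensorIface hl'
      rwa [id_tensorHom_id] at this
  | @par Δ 𝒩 Θ N M π ih =>
    cases Θ with
    | none => trivial
    | some P =>
      obtain ⟨g, hl, hu⟩ := ih
      refine ⟨g ≫ (α_ _ _ _).inv, ?_, Focused.undagger ?_⟩
      rotate_left
      · rw [negMap, unfoldedMp_par]
        exact hu.dagger.par
      · have := hl.par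
        rwa [id_tensorHom_id] at this
  | down π ih => exact S.focusedLayers_down _ _ _
  | up π ih => trivial

end PolarizedGoI

theorem quasiSnd_quasiInr {C : Type u} [Category.{v} C] [MonoidalCategory C]
    [Limits.HasZeroMorphisms C] (X X' Y : C) :
    quasiSnd X Y ≫ quasiInr X' Y = (0 : X ⟶ X') ▷ Y := by
  simp [quasiSnd, quasiInr, ← comp_whiskerRight]

end

theorem mainTheorem2 {C : Type u} [Category.{v} C] [MonoidalCategory C] [SymmetricCategory C]
    [TracedCategory C] [Limits.HasZeroMorphisms C] (S : PolarizedGoI C) {At : Type w}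
    {Δ : List (Form At .pos)} {𝒩 : List (Form At .neg)} {P : Form At .pos}
    (π : Proof Δ 𝒩 (some P)) :
    S.mpPos 𝒩 P ≫ S.exUpper π =
        (S.exLowerRestrict π ≫ quasiSnd (S.oneObj P) (negObj S.asgOne 𝒩)) ≫ S.mpNeg 𝒩 P ∧
      RangesOverRight (S.exLowerRestrict π) := by
  obtain ⟨g, hl, hu⟩ := S.focusedLayers π
  -- All points of the lower layer are identities, so focusing says directly that the restriction is
  -- `g` into 𝒩.
  have h₁ : S.exLowerRestrict π = g ≫ quasiInr _ _ := by
    have := hl _ (S.cutTwist_sigmaStar Δ)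
    rwa [negMap_id, Category.id_comp, Category.id_comp] at this
  have h₂ : S.mpPos 𝒩 P ≫ S.exUpper π = g ≫ S.mpNeg 𝒩 P :=
    (Category.assoc _ _ _).trans (hu _ (S.cutTwist_sigma Δ))
  constructor
  -- Injecting into 𝟙_𝒩 and projecting back need not be the identity, for instance when 𝒩 is empty;
  -- the zero scalar is absorbed by the quasi-injection at the end of `mpNeg`.
  · rw [h₁, h₂, PolarizedGoI.mpNeg, ← quasiInr_whiskerLeft]
    simp only [Category.assoc]
    rw [reassoc_of% quasiSnd_quasiInr, ← Category.assoc (quasiInr _ _), quasiInr_whiskerRight]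
  · rw [RangesOverRight, h₁, Category.assoc, quasiSnd_quasiInr, quasiInr_whiskerRight]
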